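/- Let $\mathcal G:\mathbb C\to\mathbb C$ satisfy the following assumptions (a bosonic thermal Green function with $\beta=2\pi$): (a) for every $k\in\mathbb Z$, $\mathcal G$ is holomorphic in the open strip $2\pi k<\operatorname{Re}\tau<2\pi(k+1)$ and its restriction to this strip extends continuously to the closed strip (the boundary values from the two sides of a line $\operatorname{Re}\tau=2\pi k$ may differ); (b) $\mathcal G(\tau+2\pi)=\mathcal G(\tau)$; (c) there are real constants $C,\alpha$ with $|\mathcal G(u+iv)|\le C(1+|v|)^\alpha$ for all $v\in\mathbb R$ and all $u\in\mathbb R\setminus 2\pi\mathbb Z$. For $m\in\mathbb Z$ let $g_m=\int_0^{2\pi}\mathcal G(\tau)e^{im\tau}\,d\tau$. Let $\mathcal G^{(+)}$ be the function that is given for $\operatorname{Im}\tau<0$ by $\frac1{2\pi}\sum_{m\ge0}g_m e^{-im\tau}$ and is continued analytically to the cut plane $\mathbb C\setminus\{2\pi k+iv: k\in\mathbb Z,\ v\ge0\}$, and let $$J^{(+,b)}_{(0)}(v)=i\lim_{\epsilon\to0^+}\{\mathcal G^{(+)}(\epsilon+iv)-\mathcal G^{(+)}(-\epsilon+iv)\}\qquad(v>0)$$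 be its jump function. Then this continuation and this limit exist, $J^{(+,b)}_{(0)}$ belongs to $L^2$ on $[0,+\infty)$ with weight $w(v)=e^{-v}$, and $$J^{(+,b)}_{(0)}(v)=e^{v/2}\sum_{\ell=0}^\infty a_\ell\,\Phi_\ell(v)\qquad(v\in\mathbb R^+),$$ where the expansion converges in the norm of that space, that is, $$\lim_{L\to\infty}\int_0^{+\infty}e^{-v}\Big|J^{(+,b)}_{(0)}(v)-e^{v/2}\sum_{\ell=0}^{L}a_\ell\Phi_\ell(v)\Big|^2dv=0 .$$ Here $$\Phi_\ell(v)=i^\ell\sqrt2\,L_\ell(2e^{-v})\,e^{-e^{-v}}e^{-v/2},\qquad a_\ell=\sqrt2\sum_{m=0}^\infty\frac{(-1)^m}{m!}\,g_{m+1}\,P_\ell\!\left[-i\left(m+\tfrac12\right)\right],$$ where the series for each $a_\ell$ converges, $L_\ell$ are the Laguerre polynomials, and $P_\ell$ are the Pollaczek polynomials of index $1/2$, that is, the real polynomials with $\deg P_\ell=\ell$ and positive leading coefficient that are orthonormal on $\mathbb R$ with weight $\frac1\pi|\Gamma(\frac12+i\eta)|^2$; equivalently $P_0=1$, $P_1(x)=2x$,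 $(\ell+2)P_{\ell+2}(x)=2xP_{\ell+1}(x)-(\ell+1)P_\ell(x)$. -/

import Mathlib

noncomputable section

namespace ThermalGreen

open Filter Topology MeasureTheory

/-- The open vertical strip `2πk < Re τ < 2π(k+1)` (the period is `β = 2π`). -/
def openStrip (k : ℤ) : Set ℂ :=
  {τ | 2 * Real.pi * k < τ.re ∧ τ.re < 2 * Real.pi * (k + 1)}

/-- The closed vertical strip `2πk ≤ Re τ ≤ 2π(k+1)`. -/
def closedStrip (k : ℤ) : Set ℂ :=
  {τ | 2 * Real.pi * k ≤ τ.re ∧ τ.re ≤ 2 * Real.pi * (k + 1)}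

/-- The standing assumptions on a bosonic thermal Green function at `β = 2π`. The function may be
discontinuous across the lines `Re τ = 2πk`: on each strip it is continuous up to the boundary,
and the boundary values obtained from the two sides of a line may differ. -/
structure IsBosonGreenFunction (G : ℂ → ℂ) : Prop where
  /-- analytic in the open strips -/
  analytic : ∀ k : ℤ, DifferentiableOn ℂ G (openStrip k)
  /-- continuous up to the boundary of each strip -/
  boundary : ∀ k : ℤ, ∃ g : ℂ → ℂ, ContinuousOn g (closedStrip k) ∧ Set.EqOn g G (openStrip k)
  /-- periodic with period `β = 2π` -/
  periodic : ∀ τ : ℂ, G (τ + 2 * Real.pi) = G τ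
  /-- slow growth in the imaginary direction, uniformly over all the strips -/
  slow_growth : ∃ C α : ℝ, ∀ k : ℤ, ∀ τ ∈ openStrip k, ‖G τ‖ ≤ C * (1 + |τ.im|) ^ α

/-- The Matsubara Fourier coefficient `∫₀^{2π} G(τ) e^{imτ} dτ`. -/
def matsubaraCoeff (G : ℂ → ℂ) (m : ℤ) : ℂ :=
  ∫ u in (0 : ℝ)..(2 * Real.pi), G u * Complex.exp (Complex.I * m * u)

/-- The complex plane cut along the half-lines `Re τ = 2πk`, `Im τ ≥ 0`. -/
def cutPlane : Set ℂ :=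
  {τ | ∀ k : ℤ, τ.re = 2 * Real.pi * k → τ.im < 0}

/-- `F` is holomorphic in the cut plane and is given in the lower half-plane by the
part `n ≥ 0` of the Fourier series of `G`. -/
def IsPlusPart (G F : ℂ → ℂ) : Prop :=
  DifferentiableOn ℂ F cutPlane ∧
    ∀ τ : ℂ, τ.im < 0 →
      HasSum (fun m : ℕ => 1 / (2 * Real.pi) * matsubaraCoeff G m * Complex.exp (-Complex.I * m * τ))
        (F τ)

open Classical in
/-- The function `G⁽⁺⁾`: the part `n ≥ 0` of the Fourier series of `G`, continued analytically
to the cut plane (the default value `0` is used only if there is no such continuation). -/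
def plusPart (G : ℂ → ℂ) : ℂ → ℂ :=
  if h : ∃ F : ℂ → ℂ, IsPlusPart G F then Classical.choose h else 0

/-- The difference `i (G⁽⁺⁾(ε + iv) - G⁽⁺⁾(-ε + iv))`, whose limit as `ε → 0+` is the jump. -/
def discontinuity (G : ℂ → ℂ) (v ε : ℝ) : ℂ :=
  Complex.I * (plusPart G (ε + Complex.I * v) - plusPart G (-ε + Complex.I * v))

/-- The jump function of `G⁽⁺⁾` across the cut `Re τ = 0`. -/
def jump (G : ℂ → ℂ) (v : ℝ) : ℂ :=
  limUnder (𝓝[>] (0 : ℝ)) (discontinuity G v)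

/-- The Pollaczek polynomials `P_ℓ = P_ℓ^{(1/2)}`, by their three-term recurrence
`(ℓ+2) P_{ℓ+2}(x) = 2x P_{ℓ+1}(x) - (ℓ+1) P_ℓ(x)`, `P_0 = 1`, `P_1 = 2x`.
They are orthonormal for the weight `|Γ(1/2 + ix)|² / π` on the real line. -/
def pollaczek : ℕ → Polynomial ℂ
  | 0 => 1
  | 1 => Polynomial.C 2 * Polynomial.X
  | (n + 2) => Polynomial.C (1 / ((n : ℂ) + 2)) *
      (Polynomial.C 2 * Polynomial.X * pollaczek (n + 1)
        - Polynomial.C ((n : ℂ) + 1) * pollaczek n)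

/-- The Laguerre polynomial `L_n(x) = ∑_{k ≤ n} (n choose k) (-x)^k / k!`. -/
def laguerre (n : ℕ) : Polynomial ℝ :=
  ∑ k ∈ Finset.range (n + 1),
    Polynomial.C ((-1) ^ k * (n.choose k : ℝ) / (k.factorial : ℝ)) * Polynomial.X ^ k

/-- `Φ_ℓ(v) = i^ℓ √2 L_ℓ(2e^{-v}) e^{-e^{-v}} e^{-v/2}`. -/
def Phi (l : ℕ) (v : ℝ) : ℂ :=
  Complex.I ^ l *
    ((Real.sqrt 2 * (laguerre l).eval (2 * Real.exp (-v)) * Real.exp (-Real.exp (-v))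
      * Real.exp (-v / 2) : ℝ) : ℂ)

/-- The `m`-th term `(-1)^m / m! · g_{m+1} · P_ℓ(-i(m + 1/2))`, where `g` denotes the Matsubara
Fourier coefficients. -/
def coeffTerm (G : ℂ → ℂ) (l m : ℕ) : ℂ :=
  (-1) ^ m / (m.factorial : ℂ) * matsubaraCoeff G (m + 1) *
    (pollaczek l).eval (-Complex.I * ((m : ℂ) + 1 / 2))

/-- The coefficient `a_ℓ = √2 ∑_m (-1)^m / m! · g_{m+1} · P_ℓ(-i(m + 1/2))`. -/
def coeff (G : ℂ → ℂ) (l : ℕ) : ℂ :=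
  (Real.sqrt 2 : ℂ) * ∑' m : ℕ, coeffTerm G l m

/-- The measure `e^{-v} dv` on `[0, ∞)`. -/
def weightMeasure : Measure ℝ :=
  (volume.restrict (Set.Ici 0)).withDensity (fun v => ENNReal.ofReal (Real.exp (-v)))

end ThermalGreen

end

noncomputable section

namespace ThermalGreen

open Filter Topology MeasureTheory

/-! The jump is the boundary jump of `G` itself in disguise. Let `J v` be `i` times the left minus
the right boundary value of `G` on the strip at height `v`. Cauchy's theorem turns `g_{m+1}` into
the Laplace transform of `J` at `m + 1` (`exists_boundary_jump`), and `t = e^{-v}` turns this into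
the moment `∫₀¹ j(t) t^m dt` of `j(t) = J(-log t)`. Summing the geometric series, the plus part is
`(g_0 + C(e^{iτ})) / 2π` with `C` the Cauchy transform of `j`. This is holomorphic on the cut plane,
which gives the continuation (`isPlusPart_cauchyTransform`), and the Sokhotski–Plemelj relation
gives the jump `j(e^{-v})` (`tendsto_discontinuity`).

Slow growth of `G` puts `j` in `L²(0,1)`. Extended by zero, it expands in the complete orthonormal
system `√2 L_l(2t) e^{-t}` of `L²(0,∞)` (`tendsto_eLpNorm_laguerre_expansion`). The Taylor
coefficients of `L_l(2t) e^{-t}` are `(-1)^m / m!` times Delannoy numbers, and these are `i^l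
P_l(-i(m + 1/2))` since both satisfy the same recurrence in `l`. Integrating term by term, the
Laguerre coefficients of `j` are `i^l a_l`. -/

/-! ### Delannoy numbers and values of Pollaczek polynomials -/

/-- The Delannoy numbers, in a form that shows the symmetry. -/
def delannoy (l m : ℕ) : ℕ := ∑ k ∈ Finset.range (m + 1), l.choose k * m.choose k * 2 ^ k

lemma delannoy_eq_sum_left (l m : ℕ) :
    delannoy l m = ∑ k ∈ Finset.range (l + 1), l.choose k * m.choose k * 2 ^ k := by
  unfold delannoy
  rcases le_total l m with h | h
  · symm
    apply Finset.sum_subset (Finset.range_mono (by omega))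
    intro k _ hk
    rw [Nat.choose_eq_zero_of_lt (n := l) (by simpa using hk)]
    simp
  · apply Finset.sum_subset (Finset.range_mono (by omega))
    intro k _ hk
    rw [Nat.choose_eq_zero_of_lt (n := m) (by simpa using hk)]
    simp

/-- A combination of Pascal's rule and absorption identities; it is the summand identity behind the
telescoping in `delannoy_three_term`. -/
lemma choose_three_term (l j : ℕ) :
    ((l : ℚ) + 2) * (l + 2).choose (j + 1) =
      (2 * j + 3) * (l + 1).choose (j + 1) + (l + 1) * l.choose (j + 1) +
        (j + 1) * (l + 1).choose j := by
  have h1 : ((l + 2).choose (j + 1) : ℚ) = (l + 1).choose j + (l + 1).choose (j + 1) := by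
    exact_mod_cast Nat.choose_succ_succ (l + 1) j
  have h2 : ((l + 1).choose (j + 1) : ℚ) = l.choose j + l.choose (j + 1) := by
    exact_mod_cast Nat.choose_succ_succ l j
  have h3 : ((l : ℚ) + 1) * l.choose j = (l + 1).choose (j + 1) * (j + 1) := by
    exact_mod_cast Nat.add_one_mul_choose_eq l j
  have h4 : ((l + 1).choose (j + 1) : ℚ) * (j + 1) = (l + 1).choose j * (l + 1 - j) := by
    rcases le_or_gt j (l + 1) with h | h
    · have := Nat.choose_succ_right_eq (l + 1) j
      have h' : (((l + 1 - j : ℕ)) : ℚ) = l + 1 - j := by push_cast [h]; ring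
      rw [← h']
      exact_mod_cast this
    · rw [Nat.choose_eq_zero_of_lt h, Nat.choose_eq_zero_of_lt (by omega)]; simp
  rw [h1]
  linear_combination (1 + (l : ℚ)) * h2 + h3 - h4

/-- Creative telescoping: the summands of the recurrence differ by `T k - T (k + 1)`. The ends
vanish, `T 0` through its factor `k` and `T (m + 1)` through `m.choose (m + 1)`. -/
lemma delannoy_three_term (l m : ℕ) :
    ((l : ℚ) + 2) * delannoy (l + 2) m =
      (2 * m + 1) * delannoy (l + 1) m + (l + 1) * delannoy l m := by
  set T : ℕ → ℚ := fun k => k * m.choose k * 2 ^ k * (l + 1).choose (k - 1) with hT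
  have key : ∀ k, ((l : ℚ) + 2) * ((l + 2).choose k * m.choose k * 2 ^ k)
      - (2 * m + 1) * ((l + 1).choose k * m.choose k * 2 ^ k)
      - (l + 1) * (l.choose k * m.choose k * 2 ^ k) = T k - T (k + 1) := by
    intro k
    have h4 : (m.choose (k + 1) : ℚ) * (k + 1) = m.choose k * (m - k) := by
      rcases le_or_gt k m with h | h
      · have := Nat.choose_succ_right_eq m k
        rw [← Nat.cast_sub h]
        exact_mod_cast this
      · rw [Nat.choose_eq_zero_of_lt h, Nat.choose_eq_zero_of_lt (by omega)]; simp
    have h5 : T (k + 1) = m.choose k * (m - k) * 2 ^ (k + 1) * (l + 1).choose k := by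
      simp only [hT, Nat.add_sub_cancel]
      push_cast
      rw [← h4]; ring
    rw [h5]
    cases k with
    | zero => simp [hT]; ring
    | succ j =>
      simp only [hT, Nat.add_sub_cancel]
      push_cast
      linear_combination (m.choose (j + 1) : ℚ) * 2 ^ (j + 1) * choose_three_term l j
  have hs := Finset.sum_congr (s₁ := Finset.range (m + 1)) rfl (fun k _ => key k)
  rw [Finset.sum_range_sub'] at hs
  have h0 : T 0 - T (m + 1) = 0 := by simp [hT]
  rw [h0] at hs
  simp only [Finset.sum_sub_distrib, ← Finset.mul_sum] at hs
  simp only [delannoy]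
  push_cast
  linarith

/-- On the points `-i(m + 1/2)` the Pollaczek polynomials are Delannoy numbers. -/
lemma pollaczek_eval_eq_delannoy (m l : ℕ) :
    Complex.I ^ l * (pollaczek l).eval (-Complex.I * ((m : ℂ) + 1 / 2)) = delannoy l m := by
  induction l using Nat.strong_induction_on with
  | _ l ih =>
    match l, ih with
    | 0, _ =>
      have : delannoy 0 m = 1 := by rw [delannoy_eq_sum_left]; simp
      simp [pollaczek, this]
    | 1, _ =>
      have : delannoy 1 m = 2 * m + 1 := by
        rw [delannoy_eq_sum_left]; simp [Finset.sum_range_succ]; ring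
      rw [this]
      simp only [pollaczek, Polynomial.eval_mul, Polynomial.eval_C, Polynomial.eval_X]
      push_cast
      linear_combination (-(2 * (m : ℂ)) - 1) * Complex.I_sq
    | n + 2, ih =>
      have h0 := ih n (by omega)
      have h1 := ih (n + 1) (by omega)
      have hd : ((n : ℂ) + 2) * delannoy (n + 2) m =
          (2 * m + 1) * delannoy (n + 1) m + (n + 1) * delannoy n m := by
        exact_mod_cast congrArg (Rat.cast (K := ℂ)) (delannoy_three_term n m)
      have hn : (n : ℂ) + 2 ≠ 0 := by exact_mod_cast (by omega : n + 2 ≠ 0)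
      apply mul_left_cancel₀ hn
      rw [hd, ← h0, ← h1]
      simp only [pollaczek, Polynomial.eval_mul, Polynomial.eval_C, Polynomial.eval_X,
        Polynomial.eval_sub]
      set a := (pollaczek (n + 1)).eval (-Complex.I * ((m : ℂ) + 1 / 2))
      set b := (pollaczek n).eval (-Complex.I * ((m : ℂ) + 1 / 2))
      field_simp
      simp only [pow_succ]
      linear_combination (-(Complex.I ^ n * b * ((n : ℂ) + 1)) -
        Complex.I ^ n * Complex.I * (2 * m + 1) * a) * Complex.I_sq

/-! ### Taylor series of the Laguerre functions -/

lemma hasSum_choose_mul_exp_term (k : ℕ) (x : ℝ) :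
    HasSum (fun m : ℕ => (m.choose k : ℝ) * (x ^ m / m.factorial))
      (x ^ k / k.factorial * Real.exp x) := by
  rw [← hasSum_nat_add_iff' k]
  have h0 : ∑ i ∈ Finset.range k, (i.choose k : ℝ) * (x ^ i / i.factorial) = 0 := by
    apply Finset.sum_eq_zero
    intro i hi
    rw [Nat.choose_eq_zero_of_lt (by simpa using hi)]
    simp
  rw [h0, sub_zero]
  have h := (NormedSpace.expSeries_div_hasSum_exp x).mul_left (x ^ k / k.factorial)
  rw [← Real.exp_eq_exp_ℝ] at h
  convert! h using 2 with n
  have := Nat.add_choose_mul_factorial_mul_factorial n k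
  have h' : ((n + k).choose k : ℝ) * n.factorial * k.factorial = (n + k).factorial := by
    rw [← this]; push_cast; ring
  have hn : (n.factorial : ℝ) ≠ 0 := by positivity
  have hk : (k.factorial : ℝ) ≠ 0 := by positivity
  rw [← h']
  have hc : ((n + k).choose k : ℝ) ≠ 0 := by
    exact_mod_cast (Nat.choose_pos (by omega)).ne'
  field_simp
  ring

lemma laguerre_eval (n : ℕ) (x : ℝ) : (laguerre n).eval x =
    ∑ k ∈ Finset.range (n + 1), (-1) ^ k * (n.choose k : ℝ) / k.factorial * x ^ k := by
  simp [laguerre, Polynomial.eval_finsetSum]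

/-- The Taylor expansion of `L_l(2t) e^{-t}`. -/
lemma hasSum_delannoy (l : ℕ) (t : ℝ) :
    HasSum (fun m : ℕ => (-1) ^ m / (m.factorial : ℝ) * t ^ m * delannoy l m)
      ((laguerre l).eval (2 * t) * Real.exp (-t)) := by
  have h := hasSum_sum (s := Finset.range (l + 1)) (fun k _ =>
    (hasSum_choose_mul_exp_term k (-t)).mul_left ((l.choose k : ℝ) * 2 ^ k))
  convert! h using 1
  · ext m
    rw [delannoy_eq_sum_left]
    push_cast
    rw [Finset.mul_sum]
    apply Finset.sum_congr rfl
    intro k _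
    rw [neg_pow t]; ring
  · rw [laguerre_eval, Finset.sum_mul]
    apply Finset.sum_congr rfl
    intro k _
    rw [neg_pow t, mul_pow]; ring

/-! ### Orthonormality of the Laguerre functions -/

/-- Up to sign this is the `n`-th finite difference of `s ↦ s.choose k`; by Pascal's rule each
difference lowers `k` by one. -/
lemma alternating_sum_choose (n : ℕ) : ∀ k s : ℕ,
    ∑ i ∈ Finset.range (n + 1), (-1 : ℝ) ^ i * n.choose i * (s + i).choose k =
      if n ≤ k then (-1) ^ n * (s.choose (k - n) : ℝ) else 0 := by
  induction n with
  | zero => intro k s; simp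
  | succ n ih =>
    intro k s
    have h1 : ∑ i ∈ Finset.range (n + 1 + 1), (-1 : ℝ) ^ i * (n + 1).choose i * (s + i).choose k =
        ∑ i ∈ Finset.range (n + 1), (-1 : ℝ) ^ i * n.choose i * (s + i).choose k
        - ∑ i ∈ Finset.range (n + 1), (-1 : ℝ) ^ i * n.choose i * (s + 1 + i).choose k := by
      have e : ∑ i ∈ Finset.range (n + 1), (-1 : ℝ) ^ i * n.choose i * (s + i).choose k =
          ∑ i ∈ Finset.range (n + 1), (-1 : ℝ) ^ (i + 1) * n.choose (i + 1) * (s + (i + 1)).choose k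
          + (s.choose k : ℝ) := by
        have a := Finset.sum_range_succ (fun i => (-1 : ℝ) ^ i * n.choose i * (s + i).choose k) (n + 1)
        have b := Finset.sum_range_succ' (fun i => (-1 : ℝ) ^ i * n.choose i * (s + i).choose k) (n + 1)
        rw [a] at b
        simpa using b
      rw [Finset.sum_range_succ', e]
      simp only [Nat.choose_succ_succ, Nat.cast_add, pow_zero, Nat.choose_zero_right, Nat.cast_one,
        add_zero, mul_one, one_mul]
      rw [add_sub_right_comm, ← Finset.sum_sub_distrib]
      congr 1
      apply Finset.sum_congr rfl
      intro i _
      rw [show s + 1 + i = s + (i + 1) by ring]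
      ring
    rw [h1, ← Finset.sum_sub_distrib]
    cases k with
    | zero => simp
    | succ k =>
      have h2 : ∀ i ∈ Finset.range (n + 1), (-1 : ℝ) ^ i * n.choose i * (s + i).choose (k + 1) -
          (-1 : ℝ) ^ i * n.choose i * (s + 1 + i).choose (k + 1) =
          - ((-1 : ℝ) ^ i * n.choose i * (s + i).choose k) := by
        intro i _
        rw [show s + 1 + i = (s + i) + 1 by ring, Nat.choose_succ_succ]
        push_cast; ring
      rw [Finset.sum_congr rfl h2, Finset.sum_neg_distrib, ih]
      simp only [Nat.add_le_add_iff_right, Nat.add_sub_add_right]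
      split_ifs
      · ring
      · simp

lemma integral_pow_mul_exp_neg_mul (k : ℕ) {a : ℝ} (ha : 0 < a) :
    ∫ t in Set.Ioi (0 : ℝ), t ^ k * Real.exp (-(a * t)) = k.factorial / a ^ (k + 1) := by
  have h := Real.integral_rpow_mul_exp_neg_mul_Ioi (a := k + 1) (r := a) (by positivity) ha
  rw [Real.Gamma_nat_eq_factorial] at h
  simp only [add_sub_cancel_right, Real.rpow_natCast] at h
  rw [h]
  rw [show ((k : ℝ) + 1) = ((k + 1 : ℕ) : ℝ) by push_cast; rfl, Real.rpow_natCast, one_div, inv_pow]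
  field_simp

lemma integrableOn_pow_mul_exp_neg_mul (k : ℕ) {a : ℝ} (ha : 0 < a) :
    IntegrableOn (fun t : ℝ => t ^ k * Real.exp (-(a * t))) (Set.Ioi 0) := by
  -- A non-integrable function has integral `0` by convention, so the nonzero value already proves
  -- integrability.
  apply Integrable.of_integral_ne_zero
  rw [integral_pow_mul_exp_neg_mul k ha]
  positivity

/-- The Laguerre functions `√2 L_n(2t) e^{-t}`. -/
def laguerreFun (n : ℕ) (t : ℝ) : ℝ :=
  Real.sqrt 2 * (laguerre n).eval (2 * t) * Real.exp (-t)

/-- The vanishing for `k < n`, hidden in `k.choose n`, is the orthogonality of `L_n` to lower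
powers. Termwise Gamma integrals leave an alternating sum evaluated by `alternating_sum_choose` at
`s = k`. -/
lemma integral_pow_mul_laguerre (k n : ℕ) :
    IntegrableOn (fun t : ℝ => (2 * t) ^ k * (2 * (laguerre n).eval (2 * t) * Real.exp (-(2 * t))))
      (Set.Ioi 0) ∧
    ∫ t in Set.Ioi (0 : ℝ), (2 * t) ^ k * (2 * (laguerre n).eval (2 * t) * Real.exp (-(2 * t))) =
      (-1) ^ n * k.factorial * k.choose n := by
  have e : ∀ t : ℝ, (2 * t) ^ k * (2 * (laguerre n).eval (2 * t) * Real.exp (-(2 * t))) =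
      ∑ i ∈ Finset.range (n + 1), ((-1) ^ i * (n.choose i : ℝ) / i.factorial * 2 ^ (k + i + 1)) *
        (t ^ (k + i) * Real.exp (-(2 * t))) := by
    intro t
    rw [laguerre_eval, Finset.mul_sum, Finset.sum_mul, Finset.mul_sum]
    apply Finset.sum_congr rfl
    intro i _
    rw [mul_pow, mul_pow]; ring
  simp only [e]
  have hi : ∀ i ∈ Finset.range (n + 1), Integrable (fun t : ℝ =>
      ((-1) ^ i * (n.choose i : ℝ) / i.factorial * 2 ^ (k + i + 1)) *
        (t ^ (k + i) * Real.exp (-(2 * t)))) (volume.restrict (Set.Ioi 0)) := fun i _ =>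
    (integrableOn_pow_mul_exp_neg_mul (k + i) two_pos).const_mul _
  refine ⟨integrable_finsetSum _ hi, ?_⟩
  rw [integral_finsetSum _ hi]
  have h2 : ∀ i ∈ Finset.range (n + 1), ∫ t in Set.Ioi (0 : ℝ),
      ((-1) ^ i * (n.choose i : ℝ) / i.factorial * 2 ^ (k + i + 1)) *
        (t ^ (k + i) * Real.exp (-(2 * t))) =
      k.factorial * ((-1 : ℝ) ^ i * n.choose i * (k + i).choose k) := by
    intro i _
    rw [integral_const_mul, integral_pow_mul_exp_neg_mul _ two_pos,
      ← Nat.add_choose_mul_factorial_mul_factorial k i, ← Nat.choose_symm_add]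
    push_cast
    have : (i.factorial : ℝ) ≠ 0 := by positivity
    field_simp
  rw [Finset.sum_congr rfl h2, ← Finset.mul_sum, alternating_sum_choose]
  split_ifs with h
  · rw [Nat.choose_symm h]; ring
  · rw [Nat.choose_eq_zero_of_lt (by omega)]; simp

/-- With `m ≤ n`, expand the factor of degree `m` in powers: all moments below `n` vanish, so only
the top term can contribute, and only if `m = n`. -/
lemma integral_laguerreFun_mul (m n : ℕ) :
    ∫ t in Set.Ioi (0 : ℝ), laguerreFun m t * laguerreFun n t = if m = n then 1 else 0 := by
  wlog hmn : m ≤ n generalizing m n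
  · have := this n m (by omega)
    simp only [mul_comm (laguerreFun m _), this, eq_comm]
  have e : ∀ t : ℝ, laguerreFun m t * laguerreFun n t =
      ∑ k ∈ Finset.range (m + 1), ((-1) ^ k * (m.choose k : ℝ) / k.factorial) *
        ((2 * t) ^ k * (2 * (laguerre n).eval (2 * t) * Real.exp (-(2 * t)))) := by
    intro t
    have h2 : Real.sqrt 2 * Real.sqrt 2 = 2 := Real.mul_self_sqrt (by norm_num)
    have h3 : Real.exp (-(2 * t)) = Real.exp (-t) * Real.exp (-t) := by
      rw [← Real.exp_add]; ring_nf
    simp only [← mul_assoc]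
    simp only [← Finset.sum_mul]
    rw [← laguerre_eval, h3]
    unfold laguerreFun
    linear_combination ((laguerre m).eval (2 * t) * Real.exp (-t) *
      (laguerre n).eval (2 * t) * Real.exp (-t)) * h2
  simp only [e]
  rw [integral_finsetSum _ fun k _ => (integral_pow_mul_laguerre k n).1.const_mul _]
  simp only [integral_const_mul, (integral_pow_mul_laguerre _ n).2]
  rw [Finset.sum_range_succ, Finset.sum_eq_zero, zero_add]
  · have : (m.factorial : ℝ) ≠ 0 := by positivity
    split_ifs with h
    · subst h
      simp only [Nat.choose_self]
      field_simp
      rcases neg_one_pow_eq_or ℝ m with h | h <;> simp [h]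
    · rw [Nat.choose_eq_zero_of_lt (n := m) (k := n) (by omega)]; simp
  · intro k hk
    rw [Nat.choose_eq_zero_of_lt (n := k) (k := n) (by have := Finset.mem_range.1 hk; omega)]
    simp

/-! ### Completeness of the Laguerre functions -/

lemma memLp_pow_mul_exp_neg_mul (k : ℕ) {a : ℝ} (ha : 0 < a) :
    MemLp (fun t : ℝ => ((t ^ k * Real.exp (-(a * t)) : ℝ) : ℂ)) 2
      (volume.restrict (Set.Ioi 0)) := by
  suffices MemLp (fun t : ℝ => t ^ k * Real.exp (-(a * t))) 2 (volume.restrict (Set.Ioi 0)) from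
    this.ofReal
  rw [memLp_two_iff_integrable_sq (by fun_prop)]
  refine (integrableOn_pow_mul_exp_neg_mul (2 * k) (a := 2 * a) (by positivity)).congr
    (Eventually.of_forall fun t => ?_)
  simp only
  rw [mul_pow, ← pow_mul, ← Real.exp_nat_mul, mul_comm k 2]
  congr 2
  push_cast; ring

lemma integrable_pow_mul_exp_mul {h : ℝ → ℂ} (hh : MemLp h 2 (volume.restrict (Set.Ioi 0)))
    (k : ℕ) {a : ℝ} (ha : 0 < a) :
    Integrable (fun t : ℝ => ((t ^ k * Real.exp (-(a * t)) : ℝ) : ℂ) * h t)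
      (volume.restrict (Set.Ioi 0)) :=
  (memLp_pow_mul_exp_neg_mul k ha).integrable_mul hh

lemma laguerreFun_eq_sum (n : ℕ) (t : ℝ) : laguerreFun n t =
    ∑ k ∈ Finset.range (n + 1), (Real.sqrt 2 * ((-1) ^ k * (n.choose k : ℝ) / k.factorial * 2 ^ k)) *
      (t ^ k * Real.exp (-(1 * t))) := by
  rw [laguerreFun, laguerre_eval, Finset.mul_sum, Finset.sum_mul]
  apply Finset.sum_congr rfl
  intro k _
  rw [mul_pow, one_mul]; ring

lemma memLp_laguerreFun (n : ℕ) :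
    MemLp (fun t : ℝ => (laguerreFun n t : ℂ)) 2 (volume.restrict (Set.Ioi 0)) := by
  have : (fun t : ℝ => (laguerreFun n t : ℂ)) = fun t => ∑ k ∈ Finset.range (n + 1),
      ((Real.sqrt 2 * ((-1) ^ k * (n.choose k : ℝ) / k.factorial * 2 ^ k) : ℝ) : ℂ) *
      ((t ^ k * Real.exp (-(1 * t)) : ℝ) : ℂ) := by
    ext t
    rw [laguerreFun_eq_sum]
    push_cast
    rfl
  rw [this]
  exact memLp_finsetSum _ fun k _ => (memLp_pow_mul_exp_neg_mul k one_pos).const_mul _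

/-- Triangularity: `laguerreFun n` is a combination of `t^k e^{-t}` with `k ≤ n`, and the
coefficient at `k = n` is nonzero. -/
lemma integral_pow_mul_exp_eq_zero_of_laguerre {h : ℝ → ℂ}
    (hh : MemLp h 2 (volume.restrict (Set.Ioi 0)))
    (h0 : ∀ n, ∫ t in Set.Ioi (0 : ℝ), (laguerreFun n t : ℂ) * h t = 0) (n : ℕ) :
    ∫ t in Set.Ioi (0 : ℝ), ((t ^ n * Real.exp (-(1 * t)) : ℝ) : ℂ) * h t = 0 := by
  induction n using Nat.strong_induction_on with
  | _ n ih =>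
    have e : ∀ t : ℝ, (laguerreFun n t : ℂ) * h t = ∑ k ∈ Finset.range (n + 1),
        ((Real.sqrt 2 * ((-1) ^ k * (n.choose k : ℝ) / k.factorial * 2 ^ k) : ℝ) : ℂ) *
        (((t ^ k * Real.exp (-(1 * t)) : ℝ) : ℂ) * h t) := by
      intro t
      rw [laguerreFun_eq_sum, Complex.ofReal_sum, Finset.sum_mul]
      apply Finset.sum_congr rfl
      intro k _
      rw [Complex.ofReal_mul, mul_assoc]
    have h1 := h0 n
    simp only [e] at h1
    rw [integral_finsetSum _ fun k _ => (integrable_pow_mul_exp_mul hh k one_pos).const_mul _,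
      Finset.sum_range_succ, Finset.sum_eq_zero, zero_add, integral_const_mul, mul_eq_zero] at h1
    · refine h1.resolve_left ?_
      rw [Complex.ofReal_eq_zero]
      have : (n.factorial : ℝ) ≠ 0 := by positivity
      simp [this]
    · intro k hk
      rw [integral_const_mul, ih k (Finset.mem_range.1 hk), mul_zero]

/-- Expand the extra factor `e^{-t/2}` in its power series. The absolute series sums to `t^n e^{-(a
- 1/2)t} |h|`, still integrable because `a ≥ 1`; a step of `1` would lose all decay at `a = 1`,
hence the step `1/2`. -/
lemma integral_pow_mul_exp_eq_zero_add_half {h : ℝ → ℂ}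
    (hh : MemLp h 2 (volume.restrict (Set.Ioi 0))) {a : ℝ} (ha : 1 ≤ a)
    (h0 : ∀ n : ℕ, ∫ t in Set.Ioi (0 : ℝ), ((t ^ n * Real.exp (-(a * t)) : ℝ) : ℂ) * h t = 0)
    (n : ℕ) :
    ∫ t in Set.Ioi (0 : ℝ), ((t ^ n * Real.exp (-((a + 1 / 2) * t)) : ℝ) : ℂ) * h t = 0 := by
  have hexp : ∀ x : ℝ, HasSum (fun k : ℕ => x ^ k / k.factorial) (Real.exp x) := by
    intro x
    rw [Real.exp_eq_exp_ℝ]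
    exact NormedSpace.expSeries_div_hasSum_exp x
  have hs := hasSum_integral_of_dominated_convergence (μ := volume.restrict (Set.Ioi (0 : ℝ)))
    (F := fun (k : ℕ) (t : ℝ) => (((-(1 / 2)) ^ k / k.factorial : ℝ) : ℂ) *
      (((t ^ (n + k) * Real.exp (-(a * t)) : ℝ) : ℂ) * h t))
    (f := fun t : ℝ => ((t ^ n * Real.exp (-((a + 1 / 2) * t)) : ℝ) : ℂ) * h t)
    (fun (k : ℕ) (t : ℝ) => (t / 2) ^ k / k.factorial * ‖((t ^ n * Real.exp (-(a * t)) : ℝ) : ℂ) * h t‖)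
    (fun k => ((integrable_pow_mul_exp_mul hh (n + k) (by linarith)).const_mul _).1) ?_ ?_ ?_ ?_
  · refine hs.unique ?_
    simp only [integral_const_mul, h0, mul_zero]
    exact hasSum_zero
  · intro k
    filter_upwards [ae_restrict_mem measurableSet_Ioi] with t ht
    have ht' : 0 < t := ht
    simp only [norm_mul, Complex.norm_real, Real.norm_eq_abs, abs_div, abs_pow, abs_neg,
      Nat.abs_cast, abs_of_pos ht', Real.abs_exp]
    rw [abs_one, abs_two]
    apply le_of_eq
    rw [pow_add, div_pow t 2, div_pow 1 2, one_pow]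
    ring
  · exact Eventually.of_forall fun t => ((hexp _).mul_right _).summable
  · have : (fun t : ℝ => ∑' k : ℕ, (t / 2) ^ k / (k.factorial : ℝ) *
        ‖((t ^ n * Real.exp (-(a * t)) : ℝ) : ℂ) * h t‖) =
        fun t => ‖((t ^ n * Real.exp (-((a - 1 / 2) * t)) : ℝ) : ℂ) * h t‖ := by
      ext t
      rw [((hexp (t / 2)).mul_right _).tsum_eq]
      have e : Real.exp (-((a - 1 / 2) * t)) = Real.exp (t / 2) * Real.exp (-(a * t)) := by
        rw [← Real.exp_add]; ring_nf
      simp only [norm_mul, Complex.norm_real, Real.norm_eq_abs, Real.abs_exp, e]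
      ring
    rw [this]
    exact (integrable_pow_mul_exp_mul hh n (by linarith)).norm
  · refine Eventually.of_forall fun t => ?_
    have h1 := Complex.hasSum_ofReal.2 (hexp (-(t / 2)))
    have h2 := h1.mul_right (((t ^ n * Real.exp (-(a * t)) : ℝ) : ℂ) * h t)
    have e : Real.exp (-((a + 1 / 2) * t)) = Real.exp (-(t / 2)) * Real.exp (-(a * t)) := by
      rw [← Real.exp_add]; ring_nf
    convert! h2 using 1
    · ext k
      have : (-(t / 2)) ^ k = (-(1 / 2)) ^ k * t ^ k := by rw [← mul_pow]; ring
      rw [this]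
      push_cast
      ring
    · rw [e]; push_cast; ring

/-- In the variable `x = e^{-t/2}` a test function on `(0,∞)` becomes continuous on `[0,1]`, so
Weierstrass approximates it uniformly by polynomials in `x`, against which `f` integrates to zero.
-/
lemma ae_eq_zero_of_integral_exp_pow {f : ℝ → ℂ} (hf : IntegrableOn f (Set.Ioi 0))
    (h0 : ∀ k : ℕ, ∫ t in Set.Ioi (0 : ℝ), ((Real.exp (-(t / 2)) ^ k : ℝ) : ℂ) * f t = 0) :
    f =ᵐ[volume.restrict (Set.Ioi 0)] 0 := by
  have hexpI : ∀ t : ℝ, t ∈ Set.Ioi (0 : ℝ) → Real.exp (-(t / 2)) ∈ Set.Icc (0 : ℝ) 1 := by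
    intro t ht
    have : 0 < t := ht
    exact ⟨(Real.exp_pos _).le, Real.exp_le_one_iff.2 (by linarith)⟩
  have hint : ∀ k : ℕ, Integrable (fun t : ℝ => ((Real.exp (-(t / 2)) ^ k : ℝ) : ℂ) * f t)
      (volume.restrict (Set.Ioi 0)) := by
    intro k
    refine hf.norm.mono' (AEStronglyMeasurable.mul
      (by fun_prop : Continuous fun t : ℝ => ((Real.exp (-(t / 2)) ^ k : ℝ) : ℂ)).aestronglyMeasurable
      hf.1) ?_
    filter_upwards [ae_restrict_mem measurableSet_Ioi] with t ht
    have := hexpI t ht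
    rw [norm_mul, Complex.norm_real, Real.norm_eq_abs, abs_of_nonneg (pow_nonneg this.1 _)]
    exact mul_le_of_le_one_left (norm_nonneg _) (pow_le_one₀ this.1 this.2)
  have hpi : ∀ p : Polynomial ℝ, Integrable (fun t : ℝ => ((p.eval (Real.exp (-(t / 2))) : ℝ) : ℂ) * f t)
      (volume.restrict (Set.Ioi 0)) ∧
      ∫ t in Set.Ioi (0 : ℝ), ((p.eval (Real.exp (-(t / 2))) : ℝ) : ℂ) * f t = 0 := by
    intro p
    have e : ∀ t : ℝ, ((p.eval (Real.exp (-(t / 2))) : ℝ) : ℂ) * f t =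
        ∑ k ∈ Finset.range (p.natDegree + 1), (p.coeff k : ℂ) *
          (((Real.exp (-(t / 2)) ^ k : ℝ) : ℂ) * f t) := by
      intro t
      rw [Polynomial.eval_eq_sum_range, Complex.ofReal_sum, Finset.sum_mul]
      apply Finset.sum_congr rfl
      intro k _
      rw [Complex.ofReal_mul, mul_assoc]
    simp only [e]
    refine ⟨integrable_finsetSum _ fun k _ => (hint k).const_mul _, ?_⟩
    rw [integral_finsetSum _ fun k _ => (hint k).const_mul _]
    simp only [integral_const_mul, h0, mul_zero, Finset.sum_const_zero]
  have key : ∀ g : ℝ → ℝ, Continuous g → HasCompactSupport g → tsupport g ⊆ Set.Ioi 0 →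
      ∫ t in Set.Ioi (0 : ℝ), (g t : ℂ) * f t = 0 := by
    intro g hg hgc hgs
    -- Since `Real.log 0 = 0`, the transported function takes the value `g 0` at `x = 0`; it must
    -- agree with the limit `0` there.
    have hg0 : g 0 = 0 := by
      by_contra hne
      exact lt_irrefl (0 : ℝ) (hgs (subset_tsupport g hne))
    obtain ⟨R, hR⟩ := hgc.isCompact.bddAbove
    have hR' : ∀ x, R < x → g x = 0 := by
      intro x hx
      by_contra hne
      exact absurd (hR (subset_tsupport g hne)) (not_le.2 hx)
    have hF : ContinuousOn (fun x => g (-2 * Real.log x)) (Set.Icc 0 1) := by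
      intro x hx
      rcases hx.1.eq_or_lt with h | h
      · subst h
        have h1 : ∀ᶠ y in 𝓝 (0 : ℝ), g (-2 * Real.log y) = 0 := by
          have hl : Tendsto (fun y => -2 * Real.log y) (𝓝[≠] 0) atTop :=
            Real.tendsto_log_nhdsNE_zero.const_mul_atBot_of_neg (by norm_num)
          have h2 := eventually_nhdsWithin_iff.1 (hl.eventually_gt_atTop R)
          filter_upwards [h2] with y hy
          by_cases hy0 : y = 0
          · subst hy0; simp [hg0]
          · exact hR' _ (hy hy0)
        have h3 : Tendsto (fun x => g (-2 * Real.log x)) (𝓝 0) (𝓝 0) :=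
          tendsto_const_nhds.congr' (h1.mono fun y hy => hy.symm)
        have h4 : ContinuousAt (fun x => g (-2 * Real.log x)) 0 := by
          rw [ContinuousAt]
          simpa [hg0] using h3
        exact h4.continuousWithinAt
      · have : ContinuousAt (fun x => g (-2 * Real.log x)) x :=
          hg.continuousAt.comp ((Real.continuousAt_log h.ne').const_mul _)
        exact this.continuousWithinAt
    have hb : ∀ ε : ℝ, 0 < ε → ‖∫ t in Set.Ioi (0 : ℝ), (g t : ℂ) * f t‖ ≤
        ε * ∫ t in Set.Ioi (0 : ℝ), ‖f t‖ := by
      intro ε hε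
      obtain ⟨p, hp⟩ := exists_polynomial_near_of_continuousOn 0 1 _ hF ε hε
      have hgi : Integrable (fun t => (g t : ℂ) * f t) (volume.restrict (Set.Ioi 0)) := by
        obtain ⟨B, hB⟩ := hgc.exists_bound_of_continuous hg
        refine Integrable.bdd_mul (c := B) hf
          (by fun_prop : Continuous fun t => (g t : ℂ)).aestronglyMeasurable ?_
        exact Eventually.of_forall fun t => by simpa using hB t
      have e : ∫ t in Set.Ioi (0 : ℝ), (g t : ℂ) * f t = ∫ t in Set.Ioi (0 : ℝ),
          ((g t : ℂ) * f t - ((p.eval (Real.exp (-(t / 2))) : ℝ) : ℂ) * f t) := by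
        rw [integral_sub hgi (hpi p).1, (hpi p).2, sub_zero]
      rw [e, ← integral_const_mul]
      refine norm_integral_le_of_norm_le (hf.norm.const_mul _) ?_
      filter_upwards [ae_restrict_mem measurableSet_Ioi] with t ht
      rw [← sub_mul, norm_mul]
      refine mul_le_mul_of_nonneg_right ?_ (norm_nonneg _)
      have := hp _ (hexpI t ht)
      rw [Real.log_exp, show -2 * -(t / 2) = t by ring, abs_sub_comm] at this
      rw [← Complex.ofReal_sub, Complex.norm_real]
      exact this.le
    have hlim : Tendsto (fun ε : ℝ => ε * ∫ t in Set.Ioi (0 : ℝ), ‖f t‖) (𝓝[>] 0) (𝓝 0) := by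
      have : Tendsto (fun ε : ℝ => ε * ∫ t in Set.Ioi (0 : ℝ), ‖f t‖) (𝓝 0)
          (𝓝 (0 * ∫ t in Set.Ioi (0 : ℝ), ‖f t‖)) := tendsto_id.mul_const _
      rw [zero_mul] at this
      exact this.mono_left nhdsWithin_le_nhds
    have := ge_of_tendsto hlim (eventually_nhdsWithin_of_forall hb)
    exact norm_le_zero_iff.1 this
  have := IsOpen.ae_eq_zero_of_integral_contDiff_smul_eq_zero (μ := volume) (f := f) isOpen_Ioi
    hf.locallyIntegrableOn (by
      intro g hg hgc hgs
      rw [← key g hg.continuous hgc hgs, setIntegral_eq_integral_of_forall_compl_eq_zero]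
      · simp
      · intro x hx
        have : g x = 0 := by
          by_contra hne
          exact hx (hgs (subset_tsupport g hne))
        simp [this])
  exact (ae_restrict_iff' measurableSet_Ioi).2 this

/-- Completeness of the Laguerre functions in `L²(0, ∞)`. -/
lemma ae_eq_zero_of_integral_laguerreFun {h : ℝ → ℂ}
    (hh : MemLp h 2 (volume.restrict (Set.Ioi 0)))
    (h0 : ∀ n, ∫ t in Set.Ioi (0 : ℝ), (laguerreFun n t : ℂ) * h t = 0) :
    h =ᵐ[volume.restrict (Set.Ioi 0)] 0 := by
  -- The decay rate climbs from `1` in steps of `1/2`. The case `n = 0` then says that `e^{-t} h`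
  -- annihilates all powers of `e^{-t/2}`.
  have hk : ∀ k n : ℕ, ∫ t in Set.Ioi (0 : ℝ),
      ((t ^ n * Real.exp (-((1 + k / 2) * t)) : ℝ) : ℂ) * h t = 0 := by
    intro k
    induction k with
    | zero =>
      intro n
      simpa using integral_pow_mul_exp_eq_zero_of_laguerre hh h0 n
    | succ k ih =>
      have h2 := integral_pow_mul_exp_eq_zero_add_half hh
        (by have : (0 : ℝ) ≤ k := Nat.cast_nonneg k
            linarith : (1 : ℝ) ≤ 1 + k / 2) ih
      convert! h2 using 9
      push_cast; ring
  have h1 := ae_eq_zero_of_integral_exp_pow (integrable_pow_mul_exp_mul hh 0 one_pos) (by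
    intro k
    rw [← hk k 0]
    congr 1
    ext t
    have e : Real.exp (-(t / 2)) ^ k * (t ^ 0 * Real.exp (-(1 * t))) =
        t ^ 0 * Real.exp (-((1 + k / 2) * t)) := by
      simp only [← Real.exp_nat_mul, pow_zero, one_mul, ← Real.exp_add]
      congr 1
      ring
    rw [← mul_assoc, ← Complex.ofReal_mul, e])
  filter_upwards [h1] with t ht
  simpa using ht

/-! ### The Laguerre expansion in `L²(0,∞)` -/

/-- The Laguerre functions as vectors of `L²(0, ∞)`. -/
def laguerreVec (n : ℕ) : Lp ℂ 2 (volume.restrict (Set.Ioi (0 : ℝ))) := (memLp_laguerreFun n).toLp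

lemma inner_laguerreVec (n : ℕ) (f : Lp ℂ 2 (volume.restrict (Set.Ioi (0 : ℝ)))) :
    inner ℂ (laguerreVec n) f = ∫ t in Set.Ioi (0 : ℝ), (laguerreFun n t : ℂ) * f t := by
  rw [L2.inner_def]
  apply integral_congr_ae
  filter_upwards [(memLp_laguerreFun n).coeFn_toLp] with t ht
  rw [laguerreVec, ht]
  simp [mul_comm]

lemma orthonormal_laguerreVec : Orthonormal ℂ laguerreVec := by
  rw [orthonormal_iff_ite]
  intro m n
  rw [inner_laguerreVec]
  have : ∫ t in Set.Ioi (0 : ℝ), (laguerreFun m t : ℂ) * laguerreVec n t =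
      ∫ t in Set.Ioi (0 : ℝ), ((laguerreFun m t * laguerreFun n t : ℝ) : ℂ) := by
    apply integral_congr_ae
    filter_upwards [(memLp_laguerreFun n).coeFn_toLp] with t ht
    rw [laguerreVec, ht]
    simp
  rw [this, integral_complex_ofReal, integral_laguerreFun_mul]
  split_ifs <;> simp

/-- The Laguerre functions as a Hilbert basis of `L²(0, ∞)`. -/
def laguerreBasis : HilbertBasis ℕ ℂ (Lp ℂ 2 (volume.restrict (Set.Ioi (0 : ℝ)))) :=
  HilbertBasis.mkOfOrthogonalEqBot orthonormal_laguerreVec (by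
    rw [Submodule.eq_bot_iff]
    intro f hf
    rw [Submodule.mem_orthogonal] at hf
    have := ae_eq_zero_of_integral_laguerreFun (Lp.memLp f) fun n => by
      rw [← inner_laguerreVec]
      exact hf _ (Submodule.subset_span ⟨n, rfl⟩)
    exact (Lp.eq_zero_iff_ae_eq_zero).2 this)

/-- The Laguerre expansion in `L²(0, ∞)`, in terms of functions. -/
lemma tendsto_eLpNorm_laguerre_expansion {f : ℝ → ℂ}
    (hf : MemLp f 2 (volume.restrict (Set.Ioi 0))) :
    Tendsto (fun N : ℕ => eLpNorm (fun t => f t - ∑ l ∈ Finset.range (N + 1),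
      (∫ s in Set.Ioi (0 : ℝ), (laguerreFun l s : ℂ) * f s) * laguerreFun l t) 2
      (volume.restrict (Set.Ioi 0))) atTop (𝓝 0) := by
  have hs := ((laguerreBasis.hasSum_repr hf.toLp).tendsto_sum_nat).comp (tendsto_add_atTop_nat 1)
  rw [tendsto_iff_edist_tendsto_0] at hs
  refine hs.congr fun N => ?_
  rw [Function.comp_apply, edist_comm, Lp.edist_def]
  apply eLpNorm_congr_ae
  have h1 : ∀ l, laguerreBasis.repr hf.toLp l • laguerreBasis l =
      ((memLp_laguerreFun l).const_mul
        (∫ s in Set.Ioi (0 : ℝ), (laguerreFun l s : ℂ) * f s)).toLp := by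
    intro l
    have hb : laguerreBasis l = laguerreVec l := by
      rw [laguerreBasis, HilbertBasis.coe_mkOfOrthogonalEqBot]
    have hi : inner ℂ (laguerreVec l) hf.toLp =
        ∫ s in Set.Ioi (0 : ℝ), (laguerreFun l s : ℂ) * f s := by
      rw [inner_laguerreVec]
      apply integral_congr_ae
      filter_upwards [hf.coeFn_toLp] with t ht
      rw [ht]
    rw [laguerreBasis.repr_apply_apply, hb, hi]
    rfl
  simp only [h1]
  have h2 : ∀ s : Finset ℕ, (∑ l ∈ s, ((memLp_laguerreFun l).const_mul
      (∫ s in Set.Ioi (0 : ℝ), (laguerreFun l s : ℂ) * f s)).toLp :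
      Lp ℂ 2 (volume.restrict (Set.Ioi (0 : ℝ)))) =ᵐ[volume.restrict (Set.Ioi 0)]
      fun t => ∑ l ∈ s, (∫ s in Set.Ioi (0 : ℝ), (laguerreFun l s : ℂ) * f s) * laguerreFun l t := by
    intro s
    induction s using Finset.induction_on with
    | empty =>
      filter_upwards [Lp.coeFn_zero ℂ 2 (volume.restrict (Set.Ioi (0 : ℝ)))] with t ht
      simpa using ht
    | insert a s ha ih =>
      rw [Finset.sum_insert ha]
      filter_upwards [ih, Lp.coeFn_add ((memLp_laguerreFun a).const_mul
        (∫ s in Set.Ioi (0 : ℝ), (laguerreFun a s : ℂ) * f s)).toLp (∑ l ∈ s,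
        ((memLp_laguerreFun l).const_mul
        (∫ s in Set.Ioi (0 : ℝ), (laguerreFun l s : ℂ) * f s)).toLp),
        ((memLp_laguerreFun a).const_mul
        (∫ s in Set.Ioi (0 : ℝ), (laguerreFun a s : ℂ) * f s)).coeFn_toLp] with t h1 h2 h3
      rw [h2, Pi.add_apply, h1, h3, Finset.sum_insert ha]
  filter_upwards [hf.coeFn_toLp, h2 (Finset.range (N + 1))] with t h3 h4
  simp only [Pi.sub_apply]
  rw [h3, h4]

/-! ### Matsubara coefficients as Laplace transforms -/

/-- Any rate below `1/2` would serve in place of `1/4`: the square of the bound must stay integrable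
against `e^{-v}`. -/
lemma exists_mul_one_add_rpow_le_exp (C α : ℝ) :
    ∃ K : ℝ, 0 ≤ K ∧ ∀ x : ℝ, 0 ≤ x → C * (1 + x) ^ α ≤ K * Real.exp (x / 4) := by
  obtain ⟨n, hn⟩ := exists_nat_ge α
  refine ⟨|C| * (4 ^ n * n.factorial * Real.exp (1 / 4)), by positivity, fun x hx => ?_⟩
  have h1 : (1 + x) ^ α ≤ (1 + x) ^ n := by
    rw [← Real.rpow_natCast]
    exact Real.rpow_le_rpow_of_exponent_le (by linarith) hn
  have h2 : (1 + x) ^ n ≤ 4 ^ n * n.factorial * Real.exp (1 / 4) * Real.exp (x / 4) := by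
    have h := Real.pow_div_factorial_le_exp ((1 + x) / 4) (by positivity) n
    rw [div_le_iff₀ (by positivity), div_pow, div_le_iff₀ (by positivity), add_div, Real.exp_add] at h
    linarith
  calc C * (1 + x) ^ α ≤ |C| * (1 + x) ^ α :=
        mul_le_mul_of_nonneg_right (le_abs_self C) (Real.rpow_nonneg (by linarith) _)
    _ ≤ |C| * (4 ^ n * n.factorial * Real.exp (1 / 4) * Real.exp (x / 4)) :=
        mul_le_mul_of_nonneg_left (h1.trans h2) (abs_nonneg C)
    _ = _ := by ring

lemma closedStrip_subset_closure : closedStrip 0 ⊆ closure (openStrip 0) := by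
  have h : openStrip 0 = Complex.re ⁻¹' Set.Ioo 0 (2 * Real.pi) := by
    ext τ; simp [openStrip]
  rw [h, Complex.closure_preimage_re, closure_Ioo Real.two_pi_pos.ne]
  intro τ hτ
  simpa [closedStrip] using hτ

lemma integrableOn_mul_exp_of_le {J : ℝ → ℂ} (hJ : Continuous J) {K : ℝ}
    (hK : ∀ v, 0 ≤ v → ‖J v‖ ≤ K * Real.exp (v / 4)) (m : ℕ) :
    IntegrableOn (fun v => J v * Complex.exp (-(((m : ℂ) + 1) * v))) (Set.Ioi 0) := by
  have hi : IntegrableOn (fun v : ℝ => K * Real.exp (-(3 / 4) * v)) (Set.Ioi 0) :=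
    (exp_neg_integrableOn_Ioi 0 (by norm_num)).const_mul _
  refine hi.mono' (by fun_prop : Continuous _).aestronglyMeasurable ?_
  filter_upwards [ae_restrict_mem measurableSet_Ioi] with v hv
  have hv' : 0 < v := hv
  have h1 := hK v hv'.le
  rw [norm_mul, Complex.norm_exp]
  have e : (-(((m : ℂ) + 1) * v)).re = -((m + 1) * v) := by simp
  rw [e]
  calc ‖J v‖ * Real.exp (-((m + 1) * v)) ≤ K * Real.exp (v / 4) * Real.exp (-v) := by
        refine mul_le_mul h1 (Real.exp_le_exp.2 ?_) (Real.exp_pos _).le ((norm_nonneg _).trans h1)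
        have : (0 : ℝ) ≤ m * v := by positivity
        linarith
    _ = K * Real.exp (-(3 / 4) * v) := by
        rw [mul_assoc, ← Real.exp_add]; ring_nf

/-- The jump of the Green function itself across the boundary of the strip, whose Laplace transform
interpolates the Matsubara coefficients of positive index. -/
lemma exists_boundary_jump {G : ℂ → ℂ} (hG : IsBosonGreenFunction G) :
    ∃ J : ℝ → ℂ, Continuous J ∧ (∃ K : ℝ, 0 ≤ K ∧ ∀ v, 0 ≤ v → ‖J v‖ ≤ K * Real.exp (v / 4)) ∧
      ∀ m : ℕ, matsubaraCoeff G (m + 1) =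
        ∫ v in Set.Ioi (0 : ℝ), J v * Complex.exp (-(((m : ℂ) + 1) * v)) := by
  obtain ⟨g, hgc, hge⟩ := hG.boundary 0
  obtain ⟨C, α, hCα⟩ := hG.slow_growth
  obtain ⟨K, hK0, hK⟩ := exists_mul_one_add_rpow_le_exp C α
  have hpi := Real.two_pi_pos
  have hgb : ∀ τ ∈ closedStrip 0, ‖g τ‖ ≤ K * Real.exp (|τ.im| / 4) := by
    -- The growth bound is given on the open strip only; continuity of `g` carries it to the two
    -- boundary lines.
    intro τ hτ
    refine ContinuousWithinAt.closure_le (closedStrip_subset_closure hτ)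
      (s := openStrip 0) (f := fun τ => ‖g τ‖) (g := fun τ => K * Real.exp (|τ.im| / 4)) ?_ ?_ ?_
    · refine ((hgc τ hτ).mono ?_).norm
      intro z hz
      exact ⟨hz.1.le, hz.2.le⟩
    · have := Complex.continuous_im
      exact (by fun_prop : Continuous fun τ : ℂ => K * Real.exp (|τ.im| / 4)).continuousWithinAt
    · intro z hz
      rw [hge hz]
      exact (hCα 0 z hz).trans (hK _ (abs_nonneg _))
  have hleft : ∀ v : ℝ, (v : ℂ) * Complex.I ∈ closedStrip 0 := by
    intro v; simp [closedStrip, hpi.le]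
  have hright : ∀ v : ℝ, ((2 * Real.pi : ℝ) : ℂ) + (v : ℂ) * Complex.I ∈ closedStrip 0 := by
    intro v; simp [closedStrip, Real.pi_pos.le]
  have hcl : Continuous fun v : ℝ => g ((v : ℂ) * Complex.I) :=
    hgc.comp_continuous (by fun_prop) hleft
  have hcr : Continuous fun v : ℝ => g (((2 * Real.pi : ℝ) : ℂ) + (v : ℂ) * Complex.I) :=
    hgc.comp_continuous (by fun_prop) hright
  set J : ℝ → ℂ := fun v => Complex.I *
    (g ((v : ℂ) * Complex.I) - g (((2 * Real.pi : ℝ) : ℂ) + (v : ℂ) * Complex.I)) with hJ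
  have hJc : Continuous J := continuous_const.mul (hcl.sub hcr)
  have hJb : ∀ v, 0 ≤ v → ‖J v‖ ≤ (2 * K) * Real.exp (v / 4) := by
    intro v hv
    have h1 := hgb _ (hleft v)
    have h2 := hgb _ (hright v)
    have e1 : ((v : ℂ) * Complex.I).im = v := by simp
    have e2 : (((2 * Real.pi : ℝ) : ℂ) + (v : ℂ) * Complex.I).im = v := by simp
    rw [e1, abs_of_nonneg hv] at h1
    rw [e2, abs_of_nonneg hv] at h2
    simp only [hJ, norm_mul, Complex.norm_I, one_mul]
    exact (norm_sub_le _ _).trans (by linarith)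
  refine ⟨J, hJc, ⟨2 * K, by positivity, hJb⟩, fun m => ?_⟩
  set f : ℂ → ℂ := fun τ => g τ * Complex.exp (Complex.I * ((m : ℂ) + 1) * τ) with hf
  -- `G` and `g` may disagree at the endpoints, a null set.
  have hm : matsubaraCoeff G (m + 1) = ∫ x in (0 : ℝ)..(2 * Real.pi), f x := by
    unfold matsubaraCoeff
    rw [intervalIntegral.integral_of_le hpi.le, intervalIntegral.integral_of_le hpi.le,
      integral_Ioc_eq_integral_Ioo, integral_Ioc_eq_integral_Ioo]
    apply setIntegral_congr_fun measurableSet_Ioo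
    intro u hu
    have : (u : ℂ) ∈ openStrip 0 := by simpa [openStrip] using hu
    simp only [hf]
    rw [hge this]
    push_cast
    rfl
  -- Cauchy's theorem on the rectangle `[0, 2π] × [0, R]`. As `m + 1` is an integer, the exponential
  -- equals `e^{-(m+1)y}` on both vertical sides, so these combine into `J`.
  have hrect : ∀ R : ℝ, 0 ≤ R → matsubaraCoeff G (m + 1) -
      (∫ x in (0 : ℝ)..(2 * Real.pi), f (x + R * Complex.I)) =
      ∫ y in (0 : ℝ)..R, J y * Complex.exp (-(((m : ℂ) + 1) * y)) := by
    intro R hR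
    have hfc : ContinuousOn f (closedStrip 0) :=
      hgc.mul (by fun_prop : Continuous _).continuousOn
    have h := Complex.integral_boundary_rect_eq_zero_of_continuousOn_of_differentiableOn f 0
      (((2 * Real.pi : ℝ) : ℂ) + R * Complex.I) (hfc.mono ?_) ?_
    · have er : (((2 * Real.pi : ℝ) : ℂ) + R * Complex.I).re = 2 * Real.pi := by simp
      have ei : (((2 * Real.pi : ℝ) : ℂ) + R * Complex.I).im = R := by simp
      rw [er, ei] at h
      simp only [Complex.zero_re, Complex.zero_im, Complex.ofReal_zero, zero_mul, add_zero,
        zero_add, smul_eq_mul] at h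
      rw [← hm] at h
      have hl : ∀ y : ℝ, f (y * Complex.I) =
          g ((y : ℂ) * Complex.I) * Complex.exp (-(((m : ℂ) + 1) * y)) := by
        intro y
        simp only [hf]
        congr 2
        linear_combination ((m : ℂ) + 1) * y * Complex.I_sq
      have hr : ∀ y : ℝ, f (((2 * Real.pi : ℝ) : ℂ) + y * Complex.I) =
          g (((2 * Real.pi : ℝ) : ℂ) + (y : ℂ) * Complex.I) *
            Complex.exp (-(((m : ℂ) + 1) * y)) := by
        intro y
        simp only [hf]
        congr 1
        rw [show Complex.I * ((m : ℂ) + 1) * (((2 * Real.pi : ℝ) : ℂ) + (y : ℂ) * Complex.I) =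
          -(((m : ℂ) + 1) * y) + ((m + 1 : ℕ) : ℂ) * (2 * Real.pi * Complex.I) by
            push_cast
            linear_combination ((m : ℂ) + 1) * y * Complex.I_sq, Complex.exp_add,
          Complex.exp_nat_mul_two_pi_mul_I, mul_one]
      simp only [hl, hr] at h
      have hJi : ∫ y in (0 : ℝ)..R, J y * Complex.exp (-(((m : ℂ) + 1) * y)) =
          Complex.I * (∫ y in (0 : ℝ)..R, g ((y : ℂ) * Complex.I) * Complex.exp (-(((m : ℂ) + 1) * y)))
          - Complex.I * (∫ y in (0 : ℝ)..R, g (((2 * Real.pi : ℝ) : ℂ) + (y : ℂ) * Complex.I) *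
            Complex.exp (-(((m : ℂ) + 1) * y))) := by
        rw [← mul_sub, ← intervalIntegral.integral_sub, ← intervalIntegral.integral_const_mul]
        · apply intervalIntegral.integral_congr
          intro y _
          simp only [hJ]
          ring
        · exact (hcl.mul (by fun_prop)).intervalIntegrable _ _
        · exact (hcr.mul (by fun_prop)).intervalIntegrable _ _
      rw [hJi]
      linear_combination h
    · intro z hz
      have h1 := hz.1
      simp only [Set.mem_preimage, Complex.zero_re, Complex.add_re, Complex.ofReal_re,
        Complex.mul_re, Complex.I_re, mul_zero, Complex.ofReal_im, Complex.I_im, zero_mul,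
        sub_self, add_zero, Set.uIcc_of_le hpi.le] at h1
      simpa [closedStrip] using h1
    · refine DifferentiableOn.mul ?_ (by fun_prop : Differentiable ℂ _).differentiableOn
      refine ((hG.analytic 0).congr fun z hz => hge hz).mono ?_
      intro z hz
      have h1 := hz.1
      simp only [Set.mem_preimage, Complex.zero_re, Complex.add_re, Complex.ofReal_re,
        Complex.mul_re, Complex.I_re, mul_zero, Complex.ofReal_im, Complex.I_im, zero_mul,
        sub_self, add_zero, min_eq_left hpi.le, max_eq_right hpi.le] at h1
      simpa [openStrip] using h1
  -- The index being at least `1`, the factor `e^{-(m+1)R}` beats the growth `e^{R/4}`.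
  have htop : Tendsto (fun R : ℝ => ∫ x in (0 : ℝ)..(2 * Real.pi), f (x + R * Complex.I)) atTop
      (𝓝 0) := by
    have hlim : Tendsto (fun R : ℝ => K * Real.exp (-(3 / 4 * R)) * |2 * Real.pi - 0|) atTop
        (𝓝 (K * 0 * |2 * Real.pi - 0|)) := by
      refine (Tendsto.const_mul _ ?_).mul_const _
      exact Real.tendsto_exp_neg_atTop_nhds_zero.comp (tendsto_id.const_mul_atTop (by norm_num))
    rw [mul_zero, zero_mul] at hlim
    refine squeeze_zero_norm' ?_ hlim
    filter_upwards [eventually_ge_atTop 0] with R hR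
    apply intervalIntegral.norm_integral_le_of_norm_le_const
    intro x hx
    rw [Set.uIoc_of_le hpi.le] at hx
    have hmem : (x : ℂ) + R * Complex.I ∈ closedStrip 0 := by
      simpa [closedStrip] using ⟨hx.1.le, hx.2⟩
    have h1 := hgb _ hmem
    have e1 : ((x : ℂ) + R * Complex.I).im = R := by simp
    rw [e1, abs_of_nonneg hR] at h1
    have e2 : (Complex.I * ((m : ℂ) + 1) * (x + R * Complex.I)).re = -((m + 1) * R) := by
      simp
    simp only [hf]
    rw [norm_mul, Complex.norm_exp, e2]
    calc _ ≤ K * Real.exp (R / 4) * Real.exp (-R) := by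
          gcongr
          have : (0 : ℝ) ≤ m * R := by positivity
          linarith
      _ = _ := by rw [mul_assoc, ← Real.exp_add]; ring_nf
  have hA : Tendsto (fun R : ℝ => ∫ y in (0 : ℝ)..R, J y * Complex.exp (-(((m : ℂ) + 1) * y))) atTop
      (𝓝 (matsubaraCoeff G (m + 1) - 0)) := by
    refine (tendsto_const_nhds.sub htop).congr' ?_
    filter_upwards [eventually_ge_atTop 0] with R hR
    exact hrect R hR
  rw [sub_zero] at hA
  exact tendsto_nhds_unique hA
    (intervalIntegral_tendsto_integral_Ioi 0 (integrableOn_mul_exp_of_le hJc hJb m) tendsto_id)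

/-! ### The Cauchy transform and its jump -/

/-- The Cauchy transform of a function on `(0, 1)`. -/
def cauchyTransform (j : ℝ → ℂ) (s : ℂ) : ℂ := ∫ t in Set.Ioo (0 : ℝ) 1, j t * (s - t)⁻¹

lemma integrable_mul_inv_sub {j : ℝ → ℂ} (hj : IntegrableOn j (Set.Ioo 0 1)) {s : ℂ} {d : ℝ}
    (hd : 0 < d) (hs : ∀ t ∈ Set.Ioo (0 : ℝ) 1, d ≤ ‖s - t‖) :
    Integrable (fun t : ℝ => j t * (s - t)⁻¹) (volume.restrict (Set.Ioo 0 1)) := by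
  refine Integrable.mul_bdd (c := d⁻¹) hj
    (by fun_prop : Measurable fun t : ℝ => (s - t)⁻¹).aestronglyMeasurable ?_
  filter_upwards [ae_restrict_mem measurableSet_Ioo] with t ht
  rw [norm_inv]
  exact inv_anti₀ hd (hs t ht)

lemma exists_pos_le_norm_sub {s : ℂ} (hs : s ∉ Complex.ofReal '' Set.Icc (0 : ℝ) 1) :
    ∃ d : ℝ, 0 < d ∧ ∀ t ∈ Set.Ioo (0 : ℝ) 1, d ≤ ‖s - t‖ := by
  have hc : IsClosed (Complex.ofReal '' Set.Icc (0 : ℝ) 1) :=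
    (isCompact_Icc.image Complex.continuous_ofReal).isClosed
  obtain ⟨d, hd, hsub⟩ := Metric.isOpen_iff.1 hc.isOpen_compl s hs
  refine ⟨d, hd, fun t ht => ?_⟩
  by_contra hlt
  refine hsub (?_ : (t : ℂ) ∈ Metric.ball s d) ⟨t, Set.Ioo_subset_Icc_self ht, rfl⟩
  rw [Metric.mem_ball, dist_comm, dist_eq_norm]
  exact not_le.1 hlt

lemma differentiableAt_cauchyTransform {j : ℝ → ℂ} (hj : IntegrableOn j (Set.Ioo 0 1)) {s : ℂ}
    (hs : s ∉ Complex.ofReal '' Set.Icc (0 : ℝ) 1) : DifferentiableAt ℂ (cauchyTransform j) s := by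
  obtain ⟨d, hd, hds⟩ := exists_pos_le_norm_sub hs
  have hball : ∀ t ∈ Set.Ioo (0 : ℝ) 1, ∀ z ∈ Metric.ball s (d / 2), d / 2 ≤ ‖z - t‖ := by
    intro t ht z hz
    have h1 := hds t ht
    have h2 : ‖s - z‖ < d / 2 := by rwa [← dist_eq_norm, dist_comm]
    have h3 := norm_add_le (s - z) (z - t)
    rw [sub_add_sub_cancel] at h3
    linarith
  refine (hasDerivAt_integral_of_dominated_loc_of_deriv_le
    (F := fun (z : ℂ) (t : ℝ) => j t * (z - t)⁻¹)
    (F' := fun (z : ℂ) (t : ℝ) => j t * (-1 / (z - t) ^ 2))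
    (bound := fun t => ‖j t‖ * (1 / (d / 2) ^ 2))
    (Metric.ball_mem_nhds s (half_pos hd)) ?_ ?_ ?_ ?_ ?_ ?_).2.differentiableAt
  · exact Eventually.of_forall fun z => hj.1.mul
      (by fun_prop : Measurable fun t : ℝ => (z - t)⁻¹).aestronglyMeasurable
  · exact integrable_mul_inv_sub hj hd hds
  · exact hj.1.mul (by fun_prop : Measurable fun t : ℝ => -1 / (s - t) ^ 2).aestronglyMeasurable
  · filter_upwards [ae_restrict_mem measurableSet_Ioo] with t ht z hz
    rw [norm_mul, norm_div, norm_neg, norm_one, norm_pow]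
    have := hball t ht z hz
    gcongr
  · exact hj.norm.mul_const _
  · filter_upwards [ae_restrict_mem measurableSet_Ioo] with t ht z hz
    have hne : z - t ≠ 0 := by
      rw [← norm_pos_iff]
      exact (half_pos hd).trans_le (hball t ht z hz)
    have h := ((hasDerivAt_id z).sub_const (t : ℂ)).inv hne
    exact h.const_mul (j t)

lemma integrable_mul_pow {j : ℝ → ℂ} (hj : IntegrableOn j (Set.Ioo 0 1)) (m : ℕ) :
    Integrable (fun t : ℝ => j t * (t : ℂ) ^ m) (volume.restrict (Set.Ioo 0 1)) := by
  refine Integrable.mul_bdd (c := 1) hj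
    (by fun_prop : Continuous fun t : ℝ => (t : ℂ) ^ m).aestronglyMeasurable ?_
  filter_upwards [ae_restrict_mem measurableSet_Ioo] with t ht
  rw [norm_pow, Complex.norm_real, Real.norm_eq_abs, abs_of_pos ht.1]
  exact pow_le_one₀ ht.1.le ht.2.le

/-- The geometric series of `1 / (s - t)` in `t / s`, integrated term by term; with `s = e^{iτ}` it
becomes the Fourier series of the plus part. -/
lemma hasSum_cauchyTransform {j : ℝ → ℂ} (hj : IntegrableOn j (Set.Ioo 0 1)) {s : ℂ}
    (hs : 1 < ‖s‖) :
    HasSum (fun m : ℕ => (∫ t in Set.Ioo (0 : ℝ) 1, j t * (t : ℂ) ^ m) * (s ^ (m + 1))⁻¹)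
      (cauchyTransform j s) := by
  have hs0 : s ≠ 0 := by
    rintro rfl
    simp at hs
    linarith
  have hr : ‖s‖⁻¹ < 1 := inv_lt_one_of_one_lt₀ hs
  have h := hasSum_integral_of_dominated_convergence (μ := volume.restrict (Set.Ioo (0 : ℝ) 1))
    (F := fun (m : ℕ) (t : ℝ) => (j t * (t : ℂ) ^ m) * (s ^ (m + 1))⁻¹)
    (f := fun t : ℝ => j t * (s - t)⁻¹)
    (fun (m : ℕ) (t : ℝ) => ‖j t‖ * ‖s‖⁻¹ * ‖s‖⁻¹ ^ m)
    (fun m => ((integrable_mul_pow hj m).mul_const _).1) ?_ ?_ ?_ ?_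
  · simp only [integral_mul_const] at h
    exact h
  · intro m
    filter_upwards [ae_restrict_mem measurableSet_Ioo] with t ht
    rw [norm_mul, norm_mul, norm_inv, norm_pow, norm_pow, Complex.norm_real, Real.norm_eq_abs,
      abs_of_pos ht.1, pow_succ, mul_inv, inv_pow]
    have h1 : t ^ m ≤ 1 := pow_le_one₀ ht.1.le ht.2.le
    calc ‖j t‖ * t ^ m * ((‖s‖ ^ m)⁻¹ * ‖s‖⁻¹) ≤ ‖j t‖ * 1 * ((‖s‖ ^ m)⁻¹ * ‖s‖⁻¹) := by gcongr
      _ = _ := by ring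
  · exact Eventually.of_forall fun t =>
      (summable_geometric_of_lt_one (by positivity) hr).mul_left _
  · simp only [tsum_mul_left]
    exact (hj.norm.mul_const _).mul_const _
  · filter_upwards [ae_restrict_mem measurableSet_Ioo] with t ht
    have hlt : ‖(t : ℂ) / s‖ < 1 := by
      rw [norm_div, Complex.norm_real, Real.norm_eq_abs, abs_of_pos ht.1, div_lt_one (by linarith)]
      linarith [ht.2]
    have h1 := (hasSum_geometric_of_norm_lt_one hlt).mul_left (j t * s⁻¹)
    convert! h1 using 1
    · ext m
      rw [div_pow, pow_succ, mul_inv]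
      field_simp
    · have : s - t ≠ 0 := by
        intro h0
        rw [sub_eq_zero] at h0
        rw [h0, Complex.norm_real, Real.norm_eq_abs, abs_of_pos ht.1] at hs
        linarith [ht.2]
      have e : 1 - (t : ℂ) / s = (s - t) / s := by field_simp
      rw [e, inv_div]
      field_simp

/-- The Poisson kernel of the half-plane is an approximate identity, also when the base point moves. -/
lemma tendsto_integral_poisson {j : ℝ → ℂ} (hj : IntegrableOn j (Set.Ioo 0 1)) {x₀ : ℝ}
    (hx₀ : x₀ ∈ Set.Ioo (0 : ℝ) 1) (hc : ContinuousAt j x₀) {ι : Type*} {l : Filter ι}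
    [l.IsCountablyGenerated] {x y : ι → ℝ}
    (hx : Tendsto x l (𝓝 x₀)) (hy : Tendsto y l (𝓝[>] 0)) :
    Tendsto (fun i => ∫ t in Set.Ioo (0 : ℝ) 1,
      (1 / Real.pi * (y i / ((t - x i) ^ 2 + y i ^ 2))) • j t) l (𝓝 (j x₀)) := by
  have hy0 : Tendsto y l (𝓝 0) := hy.mono_right nhdsWithin_le_nhds
  have hypos : ∀ᶠ i in l, 0 < y i := hy.eventually self_mem_nhdsWithin
  refine tendsto_setIntegral_peak_smul_of_integrableOn_of_tendsto
    (φ := fun i t => 1 / Real.pi * (y i / ((t - x i) ^ 2 + y i ^ 2))) measurableSet_Ioo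
    measurableSet_Ioo subset_rfl self_mem_nhdsWithin (by simp) ?_ ?_ ?_ ?_ hj
    (hc.tendsto.mono_left nhdsWithin_le_nhds)
  · filter_upwards [hypos] with i hi t _
    have := Real.pi_pos
    positivity
  · intro u hu hxu
    obtain ⟨δ, hδ, hsub⟩ := Metric.isOpen_iff.1 hu x₀ hxu
    rw [Metric.tendstoUniformlyOn_iff]
    intro ε hε
    have h1 : Tendsto (fun i => 1 / Real.pi * (y i / (δ / 2) ^ 2)) l
        (𝓝 (1 / Real.pi * (0 / (δ / 2) ^ 2))) := (hy0.div_const _).const_mul _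
    rw [zero_div, mul_zero] at h1
    filter_upwards [hypos, h1.eventually_lt_const hε,
      (Metric.tendsto_nhds.1 hx) (δ / 2) (half_pos hδ)] with i hi h2 h3 t ht
    rw [Pi.zero_apply, dist_zero_left, Real.norm_eq_abs, abs_of_nonneg (by
      have := Real.pi_pos
      positivity)]
    refine lt_of_le_of_lt ?_ h2
    have h4 : δ ≤ |t - x₀| := by
      by_contra hlt
      refine ht.2 (hsub ?_)
      rw [Metric.mem_ball, Real.dist_eq]
      exact not_le.1 hlt
    rw [Real.dist_eq] at h3
    -- The kernel is centred at the moving point `x i`, within `δ / 2` of `x₀`; half of the distance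
    -- remains.
    have h5 : δ / 2 ≤ |t - x i| := by
      have := abs_add_le (t - x i) (x i - x₀)
      rw [sub_add_sub_cancel] at this
      linarith
    have h6 : (δ / 2) ^ 2 ≤ (t - x i) ^ 2 + y i ^ 2 := by
      rw [← sq_abs (t - x i)]
      have := pow_le_pow_left₀ (half_pos hδ).le h5 2
      nlinarith [sq_nonneg (y i)]
    have := Real.pi_pos
    gcongr
  -- The total mass tends to `1`: its arctangent arguments go to `±∞` because `x₀` is interior to
  -- `(0,1)`.
  · have hval : ∀ i, 0 < y i → ∫ t in Set.Ioo (0 : ℝ) 1,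
        1 / Real.pi * (y i / ((t - x i) ^ 2 + y i ^ 2)) =
        1 / Real.pi * (Real.arctan ((1 - x i) / y i) - Real.arctan ((0 - x i) / y i)) := by
      intro i hi
      rw [integral_const_mul, ← integral_Ioc_eq_integral_Ioo,
        ← intervalIntegral.integral_of_le zero_le_one]
      congr 1
      apply intervalIntegral.integral_eq_sub_of_hasDerivAt
        (f := fun t => Real.arctan ((t - x i) / y i))
      · intro t _
        have h := (((hasDerivAt_id t).sub_const (x i)).div_const (y i)).arctan
        convert! h using 1
        simp only [id]
        field_simp
        ring
      · apply Continuous.intervalIntegrable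
        refine continuous_const.div (by fun_prop) fun t => ?_
        positivity
    have hinv : Tendsto (fun i => (y i)⁻¹) l atTop := tendsto_inv_nhdsGT_zero.comp hy
    have h1 : Tendsto (fun i => Real.arctan ((1 - x i) / y i)) l (𝓝 (Real.pi / 2)) := by
      have : Tendsto (fun i => (1 - x i) / y i) l atTop := by
        simp only [div_eq_mul_inv]
        exact (hx.const_sub 1).pos_mul_atTop (by linarith [hx₀.2]) hinv
      exact (Real.tendsto_arctan_atTop.mono_right nhdsWithin_le_nhds).comp this
    have h2 : Tendsto (fun i => Real.arctan ((0 - x i) / y i)) l (𝓝 (-(Real.pi / 2))) := by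
      have : Tendsto (fun i => (0 - x i) / y i) l atBot := by
        simp only [div_eq_mul_inv]
        exact (hx.const_sub 0).neg_mul_atTop (by linarith [hx₀.1]) hinv
      exact (Real.tendsto_arctan_atBot.mono_right nhdsWithin_le_nhds).comp this
    have h3 := (h1.sub h2).const_mul (1 / Real.pi)
    have e : 1 / Real.pi * (Real.pi / 2 - -(Real.pi / 2)) = 1 := by
      have := Real.pi_pos.ne'
      field_simp
      ring
    rw [e] at h3
    refine h3.congr' ?_
    filter_upwards [hypos] with i hi
    exact (hval i hi).symm
  · exact Eventually.of_forall fun i =>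
      (by fun_prop : Measurable fun t : ℝ =>
        1 / Real.pi * (y i / ((t - x i) ^ 2 + y i ^ 2))).aestronglyMeasurable

/-- The Sokhotski–Plemelj jump relation for the Cauchy transform. -/
lemma tendsto_cauchyTransform_jump {j : ℝ → ℂ} (hj : IntegrableOn j (Set.Ioo 0 1)) {x₀ : ℝ}
    (hx₀ : x₀ ∈ Set.Ioo (0 : ℝ) 1) (hc : ContinuousAt j x₀) {ι : Type*} {l : Filter ι}
    [l.IsCountablyGenerated] {x y : ι → ℝ}
    (hx : Tendsto x l (𝓝 x₀)) (hy : Tendsto y l (𝓝[>] 0)) :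
    Tendsto (fun i => Complex.I / (2 * Real.pi) * (cauchyTransform j (x i + y i * Complex.I) -
      cauchyTransform j (x i - y i * Complex.I))) l (𝓝 (j x₀)) := by
  -- The difference of the two Cauchy kernels, times `i / 2π`, is exactly the Poisson kernel.
  refine (tendsto_integral_poisson hj hx₀ hc hx hy).congr' ?_
  filter_upwards [hy.eventually self_mem_nhdsWithin] with i hi
  have hi' : 0 < y i := hi
  have hb : ∀ t ∈ Set.Ioo (0 : ℝ) 1, y i ≤ ‖(x i + y i * Complex.I : ℂ) - t‖ := by
    intro t _
    have := Complex.abs_im_le_norm ((x i + y i * Complex.I : ℂ) - t)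
    simpa [abs_of_pos hi'] using this
  have hb' : ∀ t ∈ Set.Ioo (0 : ℝ) 1, y i ≤ ‖(x i - y i * Complex.I : ℂ) - t‖ := by
    intro t _
    have := Complex.abs_im_le_norm ((x i - y i * Complex.I : ℂ) - t)
    simpa [abs_of_pos hi'] using this
  rw [cauchyTransform, cauchyTransform,
    ← integral_sub (integrable_mul_inv_sub hj hi' hb) (integrable_mul_inv_sub hj hi' hb'),
    ← integral_const_mul]
  apply setIntegral_congr_fun measurableSet_Ioo
  intro t ht
  have h1 : (x i + y i * Complex.I : ℂ) - t ≠ 0 := norm_pos_iff.1 (hi'.trans_le (hb t ht))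
  have h2 : (x i - y i * Complex.I : ℂ) - t ≠ 0 := norm_pos_iff.1 (hi'.trans_le (hb' t ht))
  have h3 : ((t : ℂ) - x i) ^ 2 + (y i : ℂ) ^ 2 =
      ((x i + y i * Complex.I : ℂ) - t) * ((x i - y i * Complex.I : ℂ) - t) := by
    linear_combination (-(y i : ℂ) ^ 2) * -Complex.I_sq
  have hpi : (Real.pi : ℂ) ≠ 0 := Complex.ofReal_ne_zero.2 Real.pi_pos.ne'
  simp only [Complex.real_smul]
  push_cast
  rw [h3]
  field_simp
  linear_combination (2 * (y i : ℂ) * j t) * Complex.I_sq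

/-! ### The cut plane and uniqueness of the continuation -/

/-- The cuts are where `e^{iτ}` lies in `(0, 1]`. The value `0` is never attained and is included to
make the excluded set closed. -/
lemma mem_cutPlane_iff (τ : ℂ) :
    τ ∈ cutPlane ↔ Complex.exp (Complex.I * τ) ∉ Complex.ofReal '' Set.Icc (0 : ℝ) 1 := by
  have hexp : Complex.exp (Complex.I * τ) =
      (Real.exp (-τ.im) : ℂ) * (Complex.cos τ.re + Complex.sin τ.re * Complex.I) := by
    rw [← Complex.exp_mul_I, Complex.ofReal_exp, ← Complex.exp_add]
    congr 1
    conv_lhs => rw [← Complex.re_add_im τ]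
    push_cast
    linear_combination (τ.im : ℂ) * Complex.I_sq
  constructor
  · rintro h ⟨t, ht, hte⟩
    have hre := congrArg Complex.re hte
    have hn := congrArg norm hte
    have hnorm : ‖Complex.exp (Complex.I * τ)‖ = Real.exp (-τ.im) := by
      rw [Complex.norm_exp]; simp
    rw [hnorm, Complex.norm_real, Real.norm_eq_abs, abs_of_nonneg ht.1] at hn
    have hre' : (Complex.exp (Complex.I * τ)).re = Real.exp (-τ.im) * Real.cos τ.re := by
      rw [hexp, Complex.re_ofReal_mul]
      simp [Complex.cos_ofReal_re, Complex.sin_ofReal_im]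
    rw [hre', Complex.ofReal_re, hn] at hre
    have hcos : Real.cos τ.re = 1 := by
      have := (Real.exp_pos (-τ.im)).ne'
      field_simp at hre
      exact hre.symm
    obtain ⟨k, hk⟩ := (Real.cos_eq_one_iff _).1 hcos
    have him := h k (by rw [← hk]; ring)
    have : 1 < Real.exp (-τ.im) := Real.one_lt_exp_iff.2 (by linarith)
    linarith [ht.2]
  · intro h k hk
    by_contra hlt
    refine h ⟨Real.exp (-τ.im), ⟨(Real.exp_pos _).le, Real.exp_le_one_iff.2 (by linarith)⟩, ?_⟩
    have hc : Real.cos τ.re = 1 := (Real.cos_eq_one_iff _).2 ⟨k, by rw [hk]; ring⟩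
    have hs : Real.sin τ.re = 0 := Real.sin_eq_zero_iff_cos_eq.2 (Or.inl hc)
    rw [hexp, ← Complex.ofReal_cos, ← Complex.ofReal_sin, hc, hs]
    simp

lemma isOpen_cutPlane : IsOpen cutPlane := by
  have hc : IsClosed (Complex.ofReal '' Set.Icc (0 : ℝ) 1) :=
    (isCompact_Icc.image Complex.continuous_ofReal).isClosed
  have : cutPlane = (fun τ => Complex.exp (Complex.I * τ)) ⁻¹' (Complex.ofReal '' Set.Icc (0 : ℝ) 1)ᶜ := by
    ext τ
    exact mem_cutPlane_iff τ
  rw [this]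
  exact hc.isOpen_compl.preimage (by fun_prop)

lemma mem_cutPlane_of_im_neg {τ : ℂ} (h : τ.im < 0) : τ ∈ cutPlane := fun _ _ => h

/-- The vertical ray down from any point of the cut plane avoids the cuts and enters the lower
half-plane. -/
lemma isPreconnected_cutPlane : IsPreconnected cutPlane := by
  refine isPreconnected_of_forall (-Complex.I) fun y hy => ?_
  have hA : Convex ℝ {z : ℂ | z.im < 0} := convex_halfSpace_im_lt 0
  have hB : Convex ℝ {z : ℂ | z.re = y.re ∧ z.im ≤ y.im} := by
    have : {z : ℂ | z.re = y.re ∧ z.im ≤ y.im} = {z : ℂ | z.re = y.re} ∩ {z : ℂ | z.im ≤ y.im} := rfl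
    rw [this]
    refine Convex.inter ?_ (convex_halfSpace_im_le _)
    exact convex_hyperplane Complex.reLm.isLinear y.re
  refine ⟨{z : ℂ | z.im < 0} ∪ {z : ℂ | z.re = y.re ∧ z.im ≤ y.im}, ?_, Or.inl (by simp),
    Or.inr ⟨rfl, le_rfl⟩, ?_⟩
  · rintro z (hz | hz)
    · exact mem_cutPlane_of_im_neg hz
    · intro k hk
      exact hz.2.trans_lt (hy k (hz.1 ▸ hk))
  · refine IsPreconnected.union (⟨y.re, min y.im (-1)⟩ : ℂ) ?_ ?_ hA.isPreconnected hB.isPreconnected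
    · simp
    · simp

/-- The identity theorem. As `plusPart` is an arbitrary choice, this is what lets its jump be
computed from an explicit formula. -/
lemma IsPlusPart.eqOn {G F₁ F₂ : ℂ → ℂ} (h₁ : IsPlusPart G F₁) (h₂ : IsPlusPart G F₂) :
    Set.EqOn F₁ F₂ cutPlane := by
  refine (h₁.1.analyticOnNhd isOpen_cutPlane).eqOn_of_preconnected_of_eventuallyEq
    (h₂.1.analyticOnNhd isOpen_cutPlane) isPreconnected_cutPlane (z₀ := -Complex.I)
    (mem_cutPlane_of_im_neg (by simp)) ?_
  have : {z : ℂ | z.im < 0} ∈ 𝓝 (-Complex.I) :=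
    (isOpen_lt Complex.continuous_im continuous_const).mem_nhds (by simp)
  filter_upwards [this] with z hz
  exact (h₁.2 z hz).unique (h₂.2 z hz)

lemma IsPlusPart.plusPart {G F : ℂ → ℂ} (h : IsPlusPart G F) : IsPlusPart G (plusPart G) := by
  have hex : ∃ F : ℂ → ℂ, IsPlusPart G F := ⟨F, h⟩
  rw [ThermalGreen.plusPart, dif_pos hex]
  exact Classical.choose_spec hex

/-! ### The substitution `t = e^{-v}` -/

lemma injective_exp_neg : Function.Injective fun v : ℝ => Real.exp (-v) := by
  intro a b h
  exact neg_injective (Real.exp_injective h)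

lemma image_exp_neg_Ioi : (fun v : ℝ => Real.exp (-v)) '' Set.Ioi 0 = Set.Ioo 0 1 := by
  ext t
  constructor
  · rintro ⟨v, hv, rfl⟩
    exact ⟨Real.exp_pos _, Real.exp_lt_one_iff.2 (by have : 0 < v := hv; linarith)⟩
  · intro ht
    refine ⟨-Real.log t, ?_, ?_⟩
    · have := Real.log_neg ht.1 ht.2
      simpa using this
    · simp [Real.exp_log ht.1]

lemma weightMeasure_eq : weightMeasure =
    (volume.restrict (Set.Ioi 0)).withDensity (fun v => ENNReal.ofReal (Real.exp (-v))) := by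
  rw [weightMeasure, Measure.restrict_congr_set Ioi_ae_eq_Ici]

/-- The substitution `t = e^{-v}` takes the weight `e^{-v}` on `(0, ∞)` to Lebesgue measure on
`(0, 1)`. -/
lemma measurePreserving_exp_neg :
    MeasurePreserving (fun v : ℝ => Real.exp (-v)) weightMeasure (volume.restrict (Set.Ioo 0 1)) := by
  refine ⟨by fun_prop, ?_⟩
  have h := map_withDensity_abs_det_fderiv_eq_addHaar (volume : Measure ℝ)
    (s := Set.Ioi (0 : ℝ)) (f := fun v : ℝ => Real.exp (-v))
    (f' := fun v => ContinuousLinearMap.toSpanSingleton ℝ (-Real.exp (-v)))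
    measurableSet_Ioi.nullMeasurableSet
    (fun v _ => by
      have h := ((hasDerivAt_id v).neg.exp).hasFDerivAt.hasFDerivWithinAt (s := Set.Ioi (0 : ℝ))
      convert! h using 2
      simp)
    injective_exp_neg.injOn
  rw [image_exp_neg_Ioi] at h
  rw [weightMeasure_eq, ← h]
  congr 2
  ext v
  rw [ContinuousLinearMap.det_toSpanSingleton, abs_neg, Real.abs_exp]

lemma measurableEmbedding_exp_neg : MeasurableEmbedding fun v : ℝ => Real.exp (-v) :=
  (by fun_prop : Continuous fun v : ℝ => Real.exp (-v)).measurableEmbedding injective_exp_neg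

/-- A Laplace transform on `(0, ∞)` at a positive integer is a moment on `(0, 1)`. -/
lemma integral_mul_exp_eq_moment (J : ℝ → ℂ) (m : ℕ) :
    ∫ v in Set.Ioi (0 : ℝ), J v * Complex.exp (-(((m : ℂ) + 1) * v)) =
      ∫ t in Set.Ioo (0 : ℝ) 1, J (-Real.log t) * (t : ℂ) ^ m := by
  rw [← measurePreserving_exp_neg.integral_comp measurableEmbedding_exp_neg, weightMeasure_eq,
    integral_withDensity_eq_integral_toReal_smul (by fun_prop) (by simp)]
  apply integral_congr_ae
  refine Eventually.of_forall fun v => ?_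
  simp only [Real.log_exp, neg_neg]
  rw [ENNReal.toReal_ofReal (Real.exp_pos _).le, Complex.real_smul, Complex.ofReal_exp,
    mul_left_comm, ← Complex.exp_nat_mul, ← Complex.exp_add]
  congr 2
  push_cast
  ring

/-- At `v = -log t` the squared bound is `K² t^{-1/2}`, integrable at `0`. -/
lemma memLp_comp_neg_log {J : ℝ → ℂ} (hJ : Continuous J) {K : ℝ}
    (hK : ∀ v, 0 ≤ v → ‖J v‖ ≤ K * Real.exp (v / 4)) :
    MemLp (fun t => J (-Real.log t)) 2 (volume.restrict (Set.Ioo 0 1)) := by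
  have hm : AEStronglyMeasurable (fun t => J (-Real.log t)) (volume.restrict (Set.Ioo 0 1)) :=
    (hJ.measurable.comp Real.measurable_log.neg).aestronglyMeasurable
  rw [memLp_two_iff_integrable_sq_norm hm]
  have hi : Integrable (fun t : ℝ => K ^ 2 * t ^ (-(1 / 2) : ℝ)) (volume.restrict (Set.Ioo 0 1)) :=
    ((intervalIntegral.integrableOn_Ioo_rpow_iff zero_lt_one).2 (by norm_num)).const_mul _
  refine hi.mono' (hm.norm.pow 2) ?_
  filter_upwards [ae_restrict_mem measurableSet_Ioo] with t ht
  have h1 := hK (-Real.log t) (by have := Real.log_neg ht.1 ht.2; linarith)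
  rw [norm_pow, norm_norm]
  refine (pow_le_pow_left₀ (norm_nonneg _) h1 2).trans (le_of_eq ?_)
  rw [mul_pow, ← Real.exp_nat_mul, Real.rpow_def_of_pos ht.1]
  congr 2
  push_cast
  ring

/-! ### The plus part, its jump and the coefficients -/

/-- The continuation of the plus part is the Cauchy transform, in the variable `e^{iτ}`, of a
function whose moments are the Matsubara coefficients. -/
lemma isPlusPart_cauchyTransform {G : ℂ → ℂ} {j : ℝ → ℂ} (hj : IntegrableOn j (Set.Ioo 0 1))
    (hmom : ∀ m : ℕ, matsubaraCoeff G (m + 1) = ∫ t in Set.Ioo (0 : ℝ) 1, j t * (t : ℂ) ^ m) :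
    IsPlusPart G fun τ => 1 / (2 * Real.pi) *
      (matsubaraCoeff G 0 + cauchyTransform j (Complex.exp (Complex.I * τ))) := by
  refine ⟨fun τ hτ => DifferentiableAt.differentiableWithinAt ?_, fun τ hτ => ?_⟩
  · have h1 := differentiableAt_cauchyTransform hj ((mem_cutPlane_iff τ).1 hτ)
    have h2 : DifferentiableAt ℂ (fun τ => Complex.exp (Complex.I * τ)) τ := by fun_prop
    exact ((h1.comp τ h2).const_add _).const_mul _
  · have hs : 1 < ‖Complex.exp (Complex.I * τ)‖ := by
      rw [Complex.norm_exp]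
      exact Real.one_lt_exp_iff.2 (by simpa using hτ)
    have h := (hasSum_cauchyTransform hj hs).mul_left (1 / (2 * Real.pi) : ℂ)
    rw [← hasSum_nat_add_iff' 1]
    convert! h using 1
    · ext m
      rw [← hmom, ← Complex.exp_nat_mul, ← Complex.exp_neg, mul_assoc]
      push_cast
      congr 3
      ring
    · simp [mul_add]

/-- The points `±ε + iv` go to `e^{-v}(cos ε ± i sin ε)`, which approach `e^{-v}` from above and
below along a circle. Their real part varies with `ε`, so the Plemelj relation is needed with a
moving base point. -/
lemma tendsto_discontinuity {G : ℂ → ℂ} {j : ℝ → ℂ} (hj : IntegrableOn j (Set.Ioo 0 1))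
    (hmom : ∀ m : ℕ, matsubaraCoeff G (m + 1) = ∫ t in Set.Ioo (0 : ℝ) 1, j t * (t : ℂ) ^ m)
    {v : ℝ} (hv : 0 < v) (hc : ContinuousAt j (Real.exp (-v))) :
    Tendsto (discontinuity G v) (𝓝[>] 0) (𝓝 (j (Real.exp (-v)))) := by
  have hF := isPlusPart_cauchyTransform hj hmom
  have heq := hF.plusPart.eqOn hF
  have hx : Tendsto (fun ε : ℝ => Real.exp (-v) * Real.cos ε) (𝓝[>] 0) (𝓝 (Real.exp (-v))) := by
    have : Continuous fun ε : ℝ => Real.exp (-v) * Real.cos ε := by fun_prop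
    have h := this.tendsto 0
    rw [Real.cos_zero, mul_one] at h
    exact h.mono_left nhdsWithin_le_nhds
  have hsmall : ∀ᶠ ε : ℝ in 𝓝[>] 0, ε ∈ Set.Ioo 0 Real.pi := Ioo_mem_nhdsGT Real.pi_pos
  have hy : Tendsto (fun ε : ℝ => Real.exp (-v) * Real.sin ε) (𝓝[>] 0) (𝓝[>] 0) := by
    refine tendsto_nhdsWithin_iff.2 ⟨?_, ?_⟩
    · have : Continuous fun ε : ℝ => Real.exp (-v) * Real.sin ε := by fun_prop
      have h := this.tendsto 0
      rw [Real.sin_zero, mul_zero] at h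
      exact h.mono_left nhdsWithin_le_nhds
    · filter_upwards [hsmall] with ε hε
      exact mul_pos (Real.exp_pos _) (Real.sin_pos_of_mem_Ioo hε)
  refine (tendsto_cauchyTransform_jump hj
    ⟨Real.exp_pos _, Real.exp_lt_one_iff.2 (by linarith)⟩ hc hx hy).congr' ?_
  filter_upwards [hsmall] with ε hε
  -- `0 < ε` keeps off the cut at `0`, and `ε < π` off all the others.
  have hcut : ∀ σ : ℝ, |σ| = ε → (σ : ℂ) + Complex.I * v ∈ cutPlane := by
    intro σ hσ k hk
    exfalso
    have hre : ((σ : ℂ) + Complex.I * v).re = σ := by simp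
    rw [hre] at hk
    have hpi := Real.pi_pos
    rcases eq_or_ne k 0 with rfl | hk0
    · simp only [Int.cast_zero, mul_zero] at hk
      rw [hk, abs_zero] at hσ
      linarith [hε.1]
    · have h1 : (1 : ℝ) ≤ |(k : ℝ)| := by exact_mod_cast Int.one_le_abs hk0
      rw [hk, abs_mul, abs_of_pos (by positivity : 0 < 2 * Real.pi)] at hσ
      have := hε.2
      nlinarith
  have hexp : ∀ σ : ℝ, Complex.exp (Complex.I * (σ + Complex.I * v)) =
      (Real.exp (-v) * Real.cos σ : ℝ) + (Real.exp (-v) * Real.sin σ : ℝ) * Complex.I := by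
    intro σ
    have e : Complex.I * (σ + Complex.I * v) = ((-v : ℝ) : ℂ) + σ * Complex.I := by
      push_cast
      linear_combination (v : ℂ) * Complex.I_sq
    rw [e, Complex.exp_add, Complex.exp_mul_I]
    push_cast
    ring
  have h1 := heq (hcut ε (abs_of_pos hε.1))
  have h2 := heq (hcut (-ε) (by rw [abs_neg, abs_of_pos hε.1]))
  simp only [hexp] at h1 h2
  rw [Real.cos_neg, Real.sin_neg] at h2
  rw [discontinuity, h1, ← Complex.ofReal_neg, h2]
  push_cast
  rw [show ∀ a b : ℂ, a + Complex.exp (-v) * -b * Complex.I =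
    a - Complex.exp (-v) * b * Complex.I from fun a b => by ring]
  ring

/-- The series of the coefficients sums to the Laguerre coefficients. -/
lemma hasSum_coeffTerm {G : ℂ → ℂ} {j : ℝ → ℂ} (hj : IntegrableOn j (Set.Ioo 0 1))
    (hmom : ∀ m : ℕ, matsubaraCoeff G (m + 1) = ∫ t in Set.Ioo (0 : ℝ) 1, j t * (t : ℂ) ^ m)
    (l : ℕ) :
    HasSum (fun m => Complex.I ^ l * coeffTerm G l m)
      (∫ t in Set.Ioo (0 : ℝ) 1, j t * (((laguerre l).eval (2 * t) * Real.exp (-t) : ℝ) : ℂ)) := by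
  have h := hasSum_integral_of_dominated_convergence (μ := volume.restrict (Set.Ioo (0 : ℝ) 1))
    (F := fun (m : ℕ) (t : ℝ) => (j t * (t : ℂ) ^ m) * ((-1) ^ m / (m.factorial : ℂ) * delannoy l m))
    (f := fun t : ℝ => j t * (((laguerre l).eval (2 * t) * Real.exp (-t) : ℝ) : ℂ))
    (fun (m : ℕ) (t : ℝ) => ‖j t‖ * (1 / (m.factorial : ℝ) * delannoy l m))
    (fun m => ((integrable_mul_pow hj m).mul_const _).1) ?_ ?_ ?_ ?_
  · convert! h using 2 with m
    rw [integral_mul_const, ← hmom, coeffTerm, ← pollaczek_eval_eq_delannoy]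
    ring
  · intro m
    filter_upwards [ae_restrict_mem measurableSet_Ioo] with t ht
    have h1 : t ^ m ≤ 1 := pow_le_one₀ ht.1.le ht.2.le
    rw [norm_mul, norm_mul, norm_mul, norm_div, norm_pow, norm_pow, Complex.norm_real,
      Real.norm_eq_abs, abs_of_pos ht.1, norm_neg, norm_one, one_pow, Complex.norm_natCast,
      Complex.norm_natCast]
    exact mul_le_mul_of_nonneg_right (mul_le_of_le_one_right (norm_nonneg _) h1) (by positivity)
  · refine Eventually.of_forall fun t => ?_
    -- At `t = -1` the signs cancel, so the Taylor series itself provides the summable majorant.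
    have hs := (hasSum_delannoy l (-1)).summable
    refine (hs.congr fun m => ?_).mul_left _
    rw [div_mul_eq_mul_div, ← mul_pow]
    simp
  · simp only [tsum_mul_left]
    exact hj.norm.mul_const _
  · refine Eventually.of_forall fun t => ?_
    have hs := (Complex.hasSum_ofReal.2 (hasSum_delannoy l t)).mul_left (j t)
    convert! hs using 1
    ext m
    push_cast
    ring

lemma I_pow_mul_coeff {G : ℂ → ℂ} {j : ℝ → ℂ} (hj : IntegrableOn j (Set.Ioo 0 1))
    (hmom : ∀ m : ℕ, matsubaraCoeff G (m + 1) = ∫ t in Set.Ioo (0 : ℝ) 1, j t * (t : ℂ) ^ m)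
    (l : ℕ) :
    Complex.I ^ l * coeff G l = ∫ t in Set.Ioo (0 : ℝ) 1, (laguerreFun l t : ℂ) * j t := by
  rw [coeff, mul_left_comm, ← tsum_mul_left, (hasSum_coeffTerm hj hmom l).tsum_eq,
    ← integral_const_mul]
  congr 1
  ext t
  rw [laguerreFun]
  push_cast
  ring

/-- The `i^l` in `Phi` is the one that `I_pow_mul_coeff` needs, so `e^{v/2} a_l Φ_l(v)` is exactly
the `l`-th Laguerre term of `j` at `e^{-v}`. -/
lemma exp_half_mul_Phi (l : ℕ) (v : ℝ) :
    (Real.exp (v / 2) : ℂ) * Phi l v = Complex.I ^ l * laguerreFun l (Real.exp (-v)) := by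
  have h : Real.exp (v / 2) * Real.exp (-v / 2) = 1 := by
    rw [← Real.exp_add, neg_div, add_neg_cancel, Real.exp_zero]
  have hc := congrArg Complex.ofReal h
  simp only [Complex.ofReal_mul, Complex.ofReal_one] at hc
  rw [Phi, laguerreFun]
  simp only [Complex.ofReal_mul]
  linear_combination (Complex.I ^ l * (Real.sqrt 2 : ℂ) *
    ((laguerre l).eval (2 * Real.exp (-v)) : ℝ) * (Real.exp (-Real.exp (-v)) : ℝ)) * hc

end ThermalGreen

end

theorem theorem2 (G : ℂ → ℂ) (hG : ThermalGreen.IsBosonGreenFunction G) :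
    -- the continuation of the part `n ≥ 0` of the Fourier series exists
    ThermalGreen.IsPlusPart G (ThermalGreen.plusPart G) ∧
    -- the limit that defines the jump function exists
    (∀ v : ℝ, 0 < v →
      Filter.Tendsto (ThermalGreen.discontinuity G v) (nhdsWithin 0 (Set.Ioi 0))
        (nhds (ThermalGreen.jump G v))) ∧
    -- the series for the coefficients converge
    (∀ l : ℕ, Summable (ThermalGreen.coeffTerm G l)) ∧
    -- the jump function lies in the weighted space, where the expansion converges to it
    MeasureTheory.MemLp (ThermalGreen.jump G) 2 ThermalGreen.weightMeasure ∧
    Filter.Tendsto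
      (fun N : ℕ => MeasureTheory.eLpNorm
        (fun v : ℝ => ThermalGreen.jump G v -
          (Real.exp (v / 2) : ℂ) *
            ∑ l ∈ Finset.range (N + 1), ThermalGreen.coeff G l * ThermalGreen.Phi l v)
        2 ThermalGreen.weightMeasure)
      Filter.atTop (nhds 0) := by
  open ThermalGreen Filter Topology MeasureTheory in
  obtain ⟨J, hJc, ⟨K, -, hK⟩, hmat⟩ := exists_boundary_jump hG
  set j : ℝ → ℂ := fun t => J (-Real.log t) with hjdef
  have hj2 : MemLp j 2 (volume.restrict (Set.Ioo 0 1)) := memLp_comp_neg_log hJc hK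
  have hj : IntegrableOn j (Set.Ioo 0 1) := hj2.integrable one_le_two
  have hmom : ∀ m : ℕ, matsubaraCoeff G (m + 1) =
      ∫ t in Set.Ioo (0 : ℝ) 1, j t * (t : ℂ) ^ m := fun m => by
    rw [hmat, integral_mul_exp_eq_moment]
  have hlim : ∀ v : ℝ, 0 < v → Tendsto (discontinuity G v) (𝓝[>] 0) (𝓝 (j (Real.exp (-v)))) :=
    fun v hv => tendsto_discontinuity hj hmom hv
      (hJc.continuousAt.comp (Real.continuousAt_log (Real.exp_pos _).ne').neg)
  have hjump : ∀ v : ℝ, 0 < v → jump G v = j (Real.exp (-v)) := fun v hv => (hlim v hv).limUnder_eq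
  have hpos : ∀ᵐ v ∂weightMeasure, 0 < v := by
    rw [weightMeasure_eq]
    exact (withDensity_absolutelyContinuous _ _).ae_le (ae_restrict_mem measurableSet_Ioi)
  have hjump_ae : jump G =ᵐ[weightMeasure] j ∘ fun v => Real.exp (-v) := by
    filter_upwards [hpos] with v hv using hjump v hv
  refine ⟨(isPlusPart_cauchyTransform hj hmom).plusPart, fun v hv => ?_, fun l => ?_, ?_, ?_⟩
  · rw [hjump v hv]
    exact hlim v hv
  · exact (summable_mul_left_iff (pow_ne_zero l Complex.I_ne_zero)).1
      (hasSum_coeffTerm hj hmom l).summable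
  · exact (memLp_congr_ae hjump_ae).2 (hj2.comp_measurePreserving measurePreserving_exp_neg)
  · have hsub : Set.Ioo (0 : ℝ) 1 ⊆ Set.Ioi 0 := fun t ht => ht.1
    -- The Laguerre system lives on `(0,∞)` while `j` matters only on `(0,1)`; extension by zero
    -- leaves the coefficients as integrals over `(0,1)`.
    set f : ℝ → ℂ := (Set.Ioo (0 : ℝ) 1).indicator j with hf
    have hres : (volume.restrict (Set.Ioi (0 : ℝ))).restrict (Set.Ioo 0 1) =
        volume.restrict (Set.Ioo 0 1) := Measure.restrict_restrict_of_subset hsub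
    have hf2 : MemLp f 2 (volume.restrict (Set.Ioi 0)) := by
      rw [hf, memLp_indicator_iff_restrict measurableSet_Ioo, hres]
      exact hj2
    have hcoef : ∀ l, ∫ s in Set.Ioi (0 : ℝ), (laguerreFun l s : ℂ) * f s =
        Complex.I ^ l * coeff G l := by
      intro l
      rw [I_pow_mul_coeff hj hmom l, ← hres, ← integral_indicator measurableSet_Ioo]
      congr 1
      ext t
      by_cases ht : t ∈ Set.Ioo (0 : ℝ) 1
      · simp only [hf, Set.indicator_of_mem ht]
      · simp only [hf, Set.indicator_of_notMem ht, mul_zero]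
    have hexpand := tendsto_eLpNorm_laguerre_expansion hf2
    simp only [hcoef] at hexpand
    -- The weighted norm of the error is its norm over `(0,1)`, at most the norm over `(0,∞)` that
    -- tends to zero.
    refine tendsto_of_tendsto_of_tendsto_of_le_of_le tendsto_const_nhds hexpand
      (fun N => zero_le) fun N => ?_
    set r : ℝ → ℂ := fun t => f t -
      ∑ l ∈ Finset.range (N + 1), Complex.I ^ l * coeff G l * laguerreFun l t with hr
    have hrm : AEStronglyMeasurable r (volume.restrict (Set.Ioi 0)) :=
      hf2.1.sub (Finset.aestronglyMeasurable_fun_sum _ fun l _ =>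
        ((memLp_laguerreFun l).1.const_mul _))
    have hr_ae : (fun v : ℝ => jump G v - (Real.exp (v / 2) : ℂ) *
        ∑ l ∈ Finset.range (N + 1), coeff G l * Phi l v) =ᵐ[weightMeasure]
        r ∘ fun v => Real.exp (-v) := by
      filter_upwards [hpos] with v hv
      have hmem : Real.exp (-v) ∈ Set.Ioo (0 : ℝ) 1 :=
        ⟨Real.exp_pos _, Real.exp_lt_one_iff.2 (by linarith)⟩
      simp only [Function.comp_apply, hr, hf, Set.indicator_of_mem hmem]
      rw [hjump v hv, Finset.mul_sum]
      congr 1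
      apply Finset.sum_congr rfl
      intro l _
      rw [mul_left_comm, exp_half_mul_Phi]
      ring
    rw [eLpNorm_congr_ae hr_ae, eLpNorm_comp_measurePreserving
      (hrm.mono_measure (Measure.restrict_mono hsub le_rfl)) measurePreserving_exp_neg]
    exact eLpNorm_mono_measure _ (Measure.restrict_mono hsub le_rfl)
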